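/- **Theorem 3.3.** Let $J$ be James' space: the real sequences $x=(x_j)_{j\ge 1}$ with $x_j\to 0$ and $$\|x\|^2=\sup\Big\{\sum_{j=1}^{n}|x_{p_{j+1}}-x_{p_j}|^2 : n\in\mathbb N,\ 1\le p_1<\dots<p_{n+1}\Big\}<\infty ,$$ and let $J^*$ be its dual with the dual norm. Then $J^*$ has the weakly compact approximation property (W.A.P.) with constant $7$: for every weakly compact set $D\subset J^*$ and every $\varepsilon>0$ there is a weakly compact operator $V:J^*\to J^*$ with $$\sup_{x^*\in D}\|x^*-Vx^*\|<\varepsilon\quad\text{and}\quad \|V\|\le 7 .$$ Moreover $V$ can be chosen in the following form. Let $f_s^*,S_\infty^*\in J^*$ be given by $f_s^*(x)=x_s-x_{s+1}$ and $S_\infty^*(x)=x_1$, and for a finite interval $I\subset\mathbb N$ let $I^*=\sum_{s\in I}f_s^*$. Every $x^*\in J^*$ has a unique norm-convergent expansion $x^*=\sum_{s=1}^\infty a_sf_s^*+a_\infty S_\infty^*$ with scalars $a_s$, $a_\infty$. There are integers $1=n_1<n_2<\cdots$ and $1=r_1<r_2<\cdots$ (depending on $D$ and $\varepsilon$) such that,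 with $I_j=[n_{r_j},n_{r_{j+1}})$, the formula $$B_j(x^*)=\frac1{r_{j+1}-r_j}\sum_{i=r_j}^{r_{j+1}-1}\ \frac1{n_{i+1}-n_i}\sum_{s=n_i}^{n_{i+1}-1}a_s$$ defines bounded linear functionals $B_j\in J^{**}$, and an operator $V$ as above is given by $$Vx^*=x^*-\sum_{j=1}^\infty B_j(x^*)\,I_j^*\qquad(x^*\in J^*),$$ where the partial sums of the series converge in norm. -/

import Mathlib

open Filter Topology

/-! ### Weak compactness and the weakly compact approximation property -/

section WeaklyCompact

variable {E F : Type*} [NormedAddCommGroup E] [NormedSpace ℝ E]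
  [NormedAddCommGroup F] [NormedSpace ℝ F]

/-- A subset of a real normed space is weakly compact if it is compact in the weak topology. -/
def IsWeaklyCompactSet (D : Set E) : Prop :=
  IsCompact (toWeakSpace ℝ E '' D)

/-- A bounded operator is weakly compact if the image of the closed unit ball is relatively
compact in the weak topology. -/
def IsWeaklyCompactOperator (V : E →L[ℝ] F) : Prop :=
  IsCompact (closure (toWeakSpace ℝ F '' (V '' Metric.closedBall (0 : E) 1)))

/-- `E` has the weakly compact approximation property with constant `C`: for each weakly compact
`D ⊆ E` and each `ε > 0` there is a weakly compact `V : E → E` with `‖V‖ ≤ C` and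
`sup_{x ∈ D} ‖x - V x‖ < ε`. -/
def HasWAPWith (E : Type*) [NormedAddCommGroup E] [NormedSpace ℝ E] (C : ℝ) : Prop :=
  ∀ D : Set E, IsWeaklyCompactSet D → ∀ ε : ℝ, 0 < ε →
    ∃ V : E →L[ℝ] E, IsWeaklyCompactOperator V ∧ ‖V‖ ≤ C ∧
      ∃ δ : ℝ, δ < ε ∧ ∀ x ∈ D, ‖x - V x‖ ≤ δ

end WeaklyCompact

namespace James

/-! ### James' space -/

/-- The sum of squares `∑_{j < n} |x_{p (j+1)} - x_{p j}|²`. -/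
def sqVar (x : ℕ → ℝ) (n : ℕ) (p : ℕ → ℕ) : ℝ :=
  ∑ j ∈ Finset.range n, |x (p (j + 1)) - x (p j)| ^ 2

/-- All the sums `∑_{j < n} |x_{p (j+1)} - x_{p j}|²` over indices `p 0 < p 1 < ... < p n`. -/
def sqVarSet (x : ℕ → ℝ) : Set ℝ :=
  {s | ∃ (n : ℕ) (p : ℕ → ℕ), StrictMono p ∧ s = sqVar x n p}

/-- The square variation norm. -/
noncomputable def sqVarNorm (x : ℕ → ℝ) : ℝ :=
  √(sSup (sqVarSet x))

lemma sqVar_nonneg (x : ℕ → ℝ) (n : ℕ) (p : ℕ → ℕ) : 0 ≤ sqVar x n p :=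
  Finset.sum_nonneg fun _ _ => by positivity

lemma sqVarNorm_nonneg (x : ℕ → ℝ) : 0 ≤ sqVarNorm x := Real.sqrt_nonneg _

lemma sqrt_sqVar_le {x : ℕ → ℝ} (hx : BddAbove (sqVarSet x)) (n : ℕ) {p : ℕ → ℕ}
    (hp : StrictMono p) : √(sqVar x n p) ≤ sqVarNorm x :=
  Real.sqrt_le_sqrt (le_csSup hx ⟨n, p, hp, rfl⟩)

lemma bddAbove_of_sqrt_le {x : ℕ → ℝ} {C : ℝ}
    (h : ∀ n p, StrictMono p → √(sqVar x n p) ≤ C) : BddAbove (sqVarSet x) := by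
  refine ⟨C ^ 2, ?_⟩
  rintro s ⟨n, p, hp, rfl⟩
  exact (Real.sqrt_le_left ((Real.sqrt_nonneg _).trans (h n p hp))).1 (h n p hp)

lemma sqVarNorm_le {x : ℕ → ℝ} {C : ℝ}
    (h : ∀ n p, StrictMono p → √(sqVar x n p) ≤ C) : sqVarNorm x ≤ C := by
  have hC : 0 ≤ C := (Real.sqrt_nonneg _).trans (h 0 id strictMono_id)
  refine Real.sqrt_le_iff.2 ⟨hC, csSup_le ⟨_, 0, id, strictMono_id, rfl⟩ ?_⟩
  rintro s ⟨n, p, hp, rfl⟩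
  exact (Real.sqrt_le_left hC).1 (h n p hp)

lemma sqrt_sqVar_eq (x : ℕ → ℝ) (n : ℕ) (p : ℕ → ℕ) :
    √(sqVar x n p) =
      ‖(WithLp.toLp 2 fun j : Fin n => x (p (j + 1)) - x (p j) : EuclideanSpace ℝ (Fin n))‖ := by
  rw [EuclideanSpace.norm_eq, sqVar, Finset.sum_range]
  simp [Real.norm_eq_abs]

lemma sqrt_sqVar_add (x y : ℕ → ℝ) (n : ℕ) (p : ℕ → ℕ) :
    √(sqVar (x + y) n p) ≤ √(sqVar x n p) + √(sqVar y n p) := by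
  rw [sqrt_sqVar_eq, sqrt_sqVar_eq, sqrt_sqVar_eq]
  refine le_trans (le_of_eq ?_) (norm_add_le _ _)
  congr 1
  ext j
  simp only [Pi.add_apply, PiLp.add_apply]
  ring

lemma sqrt_sqVar_smul (c : ℝ) (x : ℕ → ℝ) (n : ℕ) (p : ℕ → ℕ) :
    √(sqVar (c • x) n p) = |c| * √(sqVar x n p) := by
  rw [sqrt_sqVar_eq, sqrt_sqVar_eq, ← Real.norm_eq_abs, ← norm_smul]
  congr 1
  ext j
  simp only [Pi.smul_apply, PiLp.smul_apply, smul_eq_mul]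
  ring

/-- The vector space of null sequences of finite square variation. -/
def jamesSubmodule : Submodule ℝ (ℕ → ℝ) where
  carrier := {x | Tendsto x atTop (𝓝 0) ∧ BddAbove (sqVarSet x)}
  zero_mem' := by
    refine ⟨tendsto_const_nhds, bddAbove_of_sqrt_le (C := 0) fun n p _ => ?_⟩
    simp [sqVar]
  add_mem' := by
    rintro x y ⟨hx, hx'⟩ ⟨hy, hy'⟩
    refine ⟨by simpa [Pi.add_def] using hx.add hy,
      bddAbove_of_sqrt_le (C := sqVarNorm x + sqVarNorm y) fun n p hp => ?_⟩
    exact (sqrt_sqVar_add x y n p).trans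
      (add_le_add (sqrt_sqVar_le hx' n hp) (sqrt_sqVar_le hy' n hp))
  smul_mem' := by
    rintro c x ⟨hx, hx'⟩
    refine ⟨by simpa [Pi.smul_def] using hx.const_smul c,
      bddAbove_of_sqrt_le (C := |c| * sqVarNorm x) fun n p hp => ?_⟩
    rw [sqrt_sqVar_smul]
    exact mul_le_mul_of_nonneg_left (sqrt_sqVar_le hx' n hp) (abs_nonneg c)

/-- James' space `J`: the real sequences `x` (indexed from `0`) with `x_j → 0` and
`‖x‖² = sup ∑_{j < n} |x_{p (j+1)} - x_{p j}|² < ∞`. -/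
def JamesSpace : Type := jamesSubmodule

noncomputable instance : AddCommGroup JamesSpace := inferInstanceAs (AddCommGroup jamesSubmodule)

noncomputable instance : Module ℝ JamesSpace := inferInstanceAs (Module ℝ jamesSubmodule)

/-- The underlying sequence of an element of `J`, as a linear map. -/
def JamesSpace.seq : JamesSpace →ₗ[ℝ] (ℕ → ℝ) := jamesSubmodule.subtype

lemma JamesSpace.tendsto_seq (x : JamesSpace) : Tendsto x.seq atTop (𝓝 0) := x.2.1

lemma JamesSpace.bddAbove_seq (x : JamesSpace) : BddAbove (sqVarSet x.seq) := x.2.2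

lemma JamesSpace.seq_injective : Function.Injective JamesSpace.seq :=
  Subtype.val_injective

noncomputable instance : Norm JamesSpace := ⟨fun x => sqVarNorm x.seq⟩

lemma norm_def (x : JamesSpace) : ‖x‖ = sqVarNorm x.seq := rfl

lemma abs_sub_le_norm (x : JamesSpace) {i j : ℕ} (hij : i < j) :
    |x.seq j - x.seq i| ≤ ‖x‖ := by
  have hp : StrictMono fun k : ℕ => if k = 0 then i else j + k - 1 := by
    refine strictMono_nat_of_lt_succ fun k => ?_
    by_cases hk : k = 0
    · subst hk
      simpa using hij
    · simp only [hk, if_false, Nat.add_eq_zero_iff, one_ne_zero, and_false]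
      omega
  have h := sqrt_sqVar_le x.bddAbove_seq 1 hp
  rw [norm_def]
  simpa [sqVar, Real.sqrt_sq_eq_abs] using h

lemma abs_seq_le_norm (x : JamesSpace) (i : ℕ) : |x.seq i| ≤ ‖x‖ := by
  have h1 : Tendsto (fun j => |x.seq j - x.seq i|) atTop (𝓝 |0 - x.seq i|) :=
    (x.tendsto_seq.sub_const _).abs
  have h2 := le_of_tendsto h1 ((eventually_gt_atTop i).mono fun j hj => abs_sub_le_norm x hj)
  simpa using h2

lemma normedCore : NormedSpace.Core ℝ JamesSpace where
  norm_nonneg x := sqVarNorm_nonneg _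
  norm_smul c x := by
    have key : ∀ (c : ℝ) (x : JamesSpace), ‖c • x‖ ≤ |c| * ‖x‖ := fun c x => by
      rw [norm_def, map_smul]
      refine sqVarNorm_le fun n p hp => ?_
      rw [sqrt_sqVar_smul]
      exact mul_le_mul_of_nonneg_left (sqrt_sqVar_le x.bddAbove_seq n hp) (abs_nonneg c)
    rw [Real.norm_eq_abs]
    refine le_antisymm (key c x) ?_
    by_cases hc : c = 0
    · subst hc
      rw [abs_zero, zero_mul]
      exact sqVarNorm_nonneg _
    · have h := key c⁻¹ (c • x)
      rw [inv_smul_smul₀ hc, abs_inv] at h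
      have hc' : 0 < |c| := abs_pos.2 hc
      calc |c| * ‖x‖ ≤ |c| * (|c|⁻¹ * ‖c • x‖) := mul_le_mul_of_nonneg_left h hc'.le
        _ = ‖c • x‖ := by field_simp
  norm_triangle x y := by
    rw [norm_def, map_add]
    refine sqVarNorm_le fun n p hp => (sqrt_sqVar_add _ _ n p).trans ?_
    exact add_le_add (sqrt_sqVar_le x.bddAbove_seq n hp) (sqrt_sqVar_le y.bddAbove_seq n hp)
  norm_eq_zero_iff x := by
    constructor
    · intro h
      refine JamesSpace.seq_injective ?_
      rw [map_zero]
      funext i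
      have := abs_seq_le_norm x i
      rw [h] at this
      exact abs_nonpos_iff.1 this
    · rintro rfl
      rw [norm_def, map_zero]
      refine le_antisymm (sqVarNorm_le fun n p _ => ?_) (sqVarNorm_nonneg _)
      simp [sqVar]

noncomputable instance : NormedAddCommGroup JamesSpace := NormedAddCommGroup.ofCore normedCore

noncomputable instance : NormedSpace ℝ JamesSpace := NormedSpace.ofCore normedCore

/-! ### Functionals on `J` and expansions in `J*` -/

/-- The dual `J*` with its operator norm. -/
abbrev JamesDual : Type := StrongDual ℝ JamesSpace

/-- The coordinate functional `x ↦ x_i`. -/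
noncomputable def coord (i : ℕ) : JamesDual :=
  LinearMap.mkContinuous ((LinearMap.proj i).comp JamesSpace.seq) 1 fun x => by
    simpa using abs_seq_le_norm x i

/-- The functional `f_s*` biorthogonal to the basis `f_s = e_0 + ... + e_s` of `J`: since
`x = ∑_s (x_s - x_{s+1}) f_s`, it is `x ↦ x_s - x_{s+1}`. -/
noncomputable def fStar (s : ℕ) : JamesDual := coord s - coord (s + 1)

/-- The summing functional `S_∞*`, taking `x = ∑_s c_s f_s` to `∑_s c_s`; as
`c_s = x_s - x_{s+1}` and `x_s → 0`, the sum telescopes to `x_0`. -/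
noncomputable def sInftyStar : JamesDual := coord 0

/-- The functional `I*` of the interval `I = [p, q)`, taking `∑_s c_s f_s` to
`∑_{s ∈ I} c_s`. -/
noncomputable def intervalStar (p q : ℕ) : JamesDual := ∑ s ∈ Finset.Ico p q, fStar s

/-- `φ = ∑_s a_s f_s* + a_∞ S_∞*`, with norm convergence in `J*`. -/
def IsExpansion (φ : JamesDual) (a : ℕ → ℝ) (aInf : ℝ) : Prop :=
  Tendsto (fun N : ℕ => (∑ s ∈ Finset.range N, a s • fStar s) + aInf • sInftyStar) atTop (𝓝 φ)

/-! ### Averages -/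

/-- The average of `a_p, ..., a_{q-1}`, for `p < q`. -/
noncomputable def blockAverage (a : ℕ → ℝ) (p q : ℕ) : ℝ :=
  (∑ s ∈ Finset.Ico p q, a s) / ((q : ℝ) - p)

/-- The average, over `i ∈ [r, r')`, of the averages of `a` over the blocks `[n_i, n_{i+1})`. -/
noncomputable def doubleAverage (n : ℕ → ℕ) (a : ℕ → ℝ) (r r' : ℕ) : ℝ :=
  (∑ i ∈ Finset.Ico r r', blockAverage a (n i) (n (i + 1))) / ((r' : ℝ) - r)

end James

namespace James

/-! ### Square variation along monotone index sequences -/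

/-! Write `p j = n (r j)`, let `F j` be the double average of the basis vectors `step s` over the
`j`-th block `[p j, p (j+1))`, and let `U φ = ∑ B_j(φ) I_j*`, so that `V = I - U`. Three facts carry
the proof.

Boundedness. Here `B_j(φ) = φ (F j) - coeffInf φ`, so a partial sum of `U` is the adjoint of the
interpolation `x ↦ ∑ (x_{p j} - x_{p (j+1)}) F j` minus a rank-one term. Interpolation is a
contraction: convexity reduces it to the case where each `F j` is a single step, and then it merely
resamples `x` along a monotone index map, up to a constant (`norm_interpolation_le`). Hence `‖U‖ ≤
3` and `‖V‖ ≤ 4`. The series converges because the unit vector basis is shrinking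
(`exists_abs_apply_le`), which also yields the expansion in `J*`.

Weak compactness. For `ξ` in `J**` the sequence `ξ (coord i)` has finite square variation, hence is
Cauchy. Subtracting `U` compares `coord i` only with the endpoints of its own block, so after
removal of the rank-one operator `coeffInf ⊗ S_∞*` the adjoint of `V` lands in `J`
(`exists_predual`). Banach–Alaoglu then gives weak compactness of `V`.

Smallness on `D`. Weak compactness of `D` lets the blocks `[n_i, n_{i+1})` be chosen so that every
`φ ∈ D` has a small coefficient in each of them. By the upper `ℓ²` estimate for disjoint blocks, the
coefficients of `φ` oscillate appreciably on only a bounded number of blocks. Which blocks are bad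
depends on `φ`, but their number is uniformly bounded, so a second average over sufficiently many
blocks is small uniformly on `D` (`exists_abs_doubleAverage_le`). -/

/-- Repeated indices contribute zero terms and can be deleted. The clause `q m = p n` only serves
the induction, to attach the next index. -/
lemma exists_strictMono_sqVar_eq (x : ℕ → ℝ) {p : ℕ → ℕ} (hp : Monotone p) (n : ℕ) :
    ∃ (m : ℕ) (q : ℕ → ℕ), StrictMono q ∧ q m = p n ∧ sqVar x m q = sqVar x n p := by
  induction n with
  | zero => exact ⟨0, fun k => p 0 + k, fun a b h => by simpa using h, rfl, rfl⟩
  | succ n ih =>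
    obtain ⟨m, q, hq, hqm, hs⟩ := ih
    rcases (hp n.le_succ).eq_or_lt with h | h
    · refine ⟨m, q, hq, hqm.trans h, ?_⟩
      rw [hs, sqVar, sqVar, Finset.sum_range_succ]
      simp [← h]
    · have hlt : q m < p (n + 1) := hqm ▸ h
      refine ⟨m + 1, fun k => if k ≤ m then q k else p (n + 1) + (k - (m + 1)),
        strictMono_nat_of_lt_succ fun k => ?_, by simp, ?_⟩
      · rcases lt_trichotomy k m with hk | rfl | hk
        · have h1 : k + 1 ≤ m := hk
          simp only [hk.le, h1, if_true]
          exact hq k.lt_succ_self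
        · simpa using hlt
        · have h1 : ¬ k ≤ m := by omega
          have h2 : ¬ k + 1 ≤ m := by omega
          simp only [h1, h2, if_false]
          omega
      · rw [sqVar, sqVar, Finset.sum_range_succ, Finset.sum_range_succ]
        congr 1
        · refine Eq.trans (Finset.sum_congr rfl fun j hj => ?_) hs
          have hj' := Finset.mem_range.1 hj
          have h1 : j + 1 ≤ m := hj'
          simp [hj'.le, h1]
        · simp [hqm]

lemma sqVar_le_of_monotone {x : ℕ → ℝ} (hx : BddAbove (sqVarSet x)) (n : ℕ) {p : ℕ → ℕ}
    (hp : Monotone p) : sqVar x n p ≤ sqVarNorm x ^ 2 := by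
  obtain ⟨m, q, hq, -, hs⟩ := exists_strictMono_sqVar_eq x hp n
  rw [← hs]
  exact (Real.sqrt_le_left (sqVarNorm_nonneg x)).1 (sqrt_sqVar_le hx m hq)

/-- The square variation of a sequence far out is small. -/
lemma exists_sqVar_le {x : ℕ → ℝ} (hx : BddAbove (sqVarSet x)) {η : ℝ} (hη : 0 < η) :
    ∃ N, ∀ (n : ℕ) (q : ℕ → ℕ), Monotone q → N ≤ q 0 → sqVar x n q ≤ η := by
  have hne : (sqVarSet x).Nonempty := ⟨_, 0, id, strictMono_id, rfl⟩
  obtain ⟨_, ⟨m, p, hp, rfl⟩, hm⟩ := exists_lt_of_lt_csSup hne (sub_lt_self (sSup (sqVarSet x)) hη)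
  refine ⟨p m, fun n q hq hN => ?_⟩
  -- Append `q` to the nearly maximizing `p`. The connecting jump is nonnegative and is discarded,
  -- so the variation of `q` is at most the deficit of `p` from the supremum.
  set w : ℕ → ℕ := fun j => if j ≤ m then p j else q (j - (m + 1)) with hw
  have hw' : Monotone w := by
    refine monotone_nat_of_le_succ fun k => ?_
    rcases lt_trichotomy k m with hk | rfl | hk
    · have h1 : k + 1 ≤ m := hk
      simp only [hw, hk.le, h1, if_true]
      exact hp.monotone k.le_succ
    · simpa [hw] using hN
    · have h1 : ¬ k ≤ m := by omega
      have h2 : ¬ k + 1 ≤ m := by omega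
      simp only [hw, h1, h2, if_false]
      exact hq (by omega)
  obtain ⟨m', q', hq', -, hs⟩ := exists_strictMono_sqVar_eq x hw' (m + 1 + n)
  have h1 : sqVar x (m + 1 + n) w ≤ sSup (sqVarSet x) := hs ▸ le_csSup hx ⟨_, _, hq', rfl⟩
  have h2 : sqVar x m p + sqVar x n q ≤ sqVar x (m + 1 + n) w := by
    simp only [sqVar]
    rw [Finset.sum_range_add, Finset.sum_range_succ]
    have e1 : ∑ j ∈ Finset.range m, |x (w (j + 1)) - x (w j)| ^ 2 =
        ∑ j ∈ Finset.range m, |x (p (j + 1)) - x (p j)| ^ 2 := by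
      refine Finset.sum_congr rfl fun j hj => ?_
      have hj' := Finset.mem_range.1 hj
      have h1 : j + 1 ≤ m := hj'
      simp [hw, hj'.le, h1]
    have e2 : ∑ j ∈ Finset.range n, |x (w (m + 1 + j + 1)) - x (w (m + 1 + j))| ^ 2 =
        ∑ j ∈ Finset.range n, |x (q (j + 1)) - x (q j)| ^ 2 := by
      refine Finset.sum_congr rfl fun j _ => ?_
      have h1 : ¬ m + 1 + j ≤ m := by omega
      have h2 : ¬ m + 1 + j + 1 ≤ m := by omega
      simp only [hw, h1, h2, if_false]
      congr 5 <;> omega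
    rw [e1, e2]
    have := sq_nonneg |x (w (m + 1)) - x (w m)|
    linarith
  linarith

/-- No null limit is assumed, so this applies to the sequences `ξ (coord i)` coming from `J**`. -/
lemma cauchySeq_of_bddAbove {x : ℕ → ℝ} (hx : BddAbove (sqVarSet x)) {ε : ℝ} (hε : 0 < ε) :
    ∃ N, ∀ i j, N ≤ i → N ≤ j → |x j - x i| ≤ ε := by
  obtain ⟨N, hN⟩ := exists_sqVar_le hx (pow_pos hε 2)
  have key : ∀ i j, N ≤ i → i ≤ j → |x j - x i| ≤ ε := fun i j hi hij => by
    have h := hN 1 (fun k => if k = 0 then i else j)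
      (monotone_nat_of_le_succ fun k => by by_cases hk : k = 0 <;> simp [hk, hij]) (by simpa)
    have h' : |x j - x i| ^ 2 ≤ ε ^ 2 := by simpa [sqVar] using h
    exact (sq_le_sq₀ (abs_nonneg _) hε.le).1 h'
  refine ⟨N, fun i j hi hj => ?_⟩
  rcases le_total i j with h | h
  · exact key i j hi h
  · rw [abs_sub_comm]
    exact key j i hj h

/-! ### Elements of James' space -/

/-- A null sequence of finite square variation as an element of `J`. -/
def JamesSpace.mk (x : ℕ → ℝ) (h0 : Tendsto x atTop (𝓝 0)) (hb : BddAbove (sqVarSet x)) :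
    JamesSpace := ⟨x, h0, hb⟩

lemma JamesSpace.ext_seq {x y : JamesSpace} (h : ∀ i, x.seq i = y.seq i) : x = y :=
  JamesSpace.seq_injective (funext h)

@[simp] lemma seq_add (x y : JamesSpace) (i : ℕ) : (x + y).seq i = x.seq i + y.seq i := by
  simp [map_add]

@[simp] lemma seq_sub (x y : JamesSpace) (i : ℕ) : (x - y).seq i = x.seq i - y.seq i := by
  simp [map_sub]

@[simp] lemma seq_smul (c : ℝ) (x : JamesSpace) (i : ℕ) : (c • x).seq i = c * x.seq i := by
  simp [map_smul]

@[simp] lemma seq_sum {ι : Type*} (F : Finset ι) (u : ι → JamesSpace) (i : ℕ) :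
    (∑ k ∈ F, u k).seq i = ∑ k ∈ F, (u k).seq i := by
  simp [map_sum]

@[simp] lemma coord_apply (i : ℕ) (x : JamesSpace) : coord i x = x.seq i := rfl

lemma norm_coord_le (i : ℕ) : ‖coord i‖ ≤ 1 :=
  LinearMap.mkContinuous_norm_le _ zero_le_one _

lemma sqVar_le_norm_sq (x : JamesSpace) (n : ℕ) {p : ℕ → ℕ} (hp : Monotone p) :
    sqVar x.seq n p ≤ ‖x‖ ^ 2 :=
  sqVar_le_of_monotone x.bddAbove_seq n hp

lemma norm_le_of_sqVar_le {x : JamesSpace} {C : ℝ} (hC : 0 ≤ C)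
    (h : ∀ n p, StrictMono p → sqVar x.seq n p ≤ C ^ 2) : ‖x‖ ≤ C :=
  sqVarNorm_le fun n p hp => (Real.sqrt_le_left hC).2 (h n p hp)

lemma bddAbove_of_sqVar_le {x : ℕ → ℝ} {C : ℝ} (h : ∀ n p, StrictMono p → sqVar x n p ≤ C) :
    BddAbove (sqVarSet x) := by
  refine ⟨C, ?_⟩
  rintro s ⟨n, p, hp, rfl⟩
  exact h n p hp

/-- The sequence decreases with jumps 0 or 1, so each squared jump is bounded by the drop, and the
drops telescope. -/
lemma sqVar_step_le (s n : ℕ) {p : ℕ → ℕ} (hp : StrictMono p) :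
    sqVar (fun i => if i ≤ s then 1 else 0) n p ≤ 1 := by
  set x : ℕ → ℝ := fun i => if i ≤ s then 1 else 0 with hx
  have h : ∀ j ∈ Finset.range n, |x (p (j + 1)) - x (p j)| ^ 2 ≤ x (p j) - x (p (j + 1)) := by
    intro j _
    have := hp (Nat.lt_add_one j)
    by_cases h1 : p (j + 1) ≤ s
    · have h2 : p j ≤ s := by omega
      simp [hx, h1, h2]
    · by_cases h2 : p j ≤ s <;> simp [hx, h1, h2]
  refine (Finset.sum_le_sum h).trans ?_
  rw [Finset.sum_range_sub' (fun j => x (p j))]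
  have h1 : x (p 0) ≤ 1 := by simp only [hx]; split_ifs <;> norm_num
  have h2 : 0 ≤ x (p n) := by simp only [hx]; split_ifs <;> norm_num
  linarith

/-- The basis vector `f_s = e_0 + ... + e_s` of `J`. -/
def step (s : ℕ) : JamesSpace :=
  JamesSpace.mk (fun i => if i ≤ s then 1 else 0)
    (tendsto_const_nhds.congr' ((eventually_gt_atTop s).mono fun i hi => by
      simp [not_le.2 hi]))
    (bddAbove_of_sqVar_le fun n _ hp => sqVar_step_le s n hp)

@[simp] lemma seq_step (s i : ℕ) : (step s).seq i = if i ≤ s then 1 else 0 := rfl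

lemma norm_step_le (s : ℕ) : ‖step s‖ ≤ 1 :=
  norm_le_of_sqVar_le zero_le_one fun n p hp => by
    rw [one_pow]
    exact sqVar_step_le s n hp

/-- Composition with a monotone index map does not increase the square variation; the map may
collapse indices, which is why monotone sequences had to be admitted. -/
lemma sqVar_max_le (x : JamesSpace) (N n : ℕ) {p : ℕ → ℕ} (hp : StrictMono p) :
    sqVar (fun i => x.seq (max i N)) n p ≤ ‖x‖ ^ 2 :=
  sqVar_le_norm_sq x n (p := fun j => max (p j) N)
    fun _ _ h => max_le_max (hp.monotone h) le_rfl

lemma tendsto_max_atTop (N : ℕ) : Tendsto (fun i : ℕ => max i N) atTop atTop :=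
  tendsto_atTop_mono (fun i => le_max_left i N) tendsto_id

/-- The sequence `x` made constant before `N`. -/
noncomputable def flatten (N : ℕ) (x : JamesSpace) : JamesSpace :=
  JamesSpace.mk (fun i => x.seq (max i N)) (x.tendsto_seq.comp (tendsto_max_atTop N))
    (bddAbove_of_sqVar_le fun n _ hp => sqVar_max_le x N n hp)

@[simp] lemma seq_flatten (N : ℕ) (x : JamesSpace) (i : ℕ) :
    (flatten N x).seq i = x.seq (max i N) := rfl

lemma norm_flatten_le (N : ℕ) (x : JamesSpace) : ‖flatten N x‖ ≤ ‖x‖ :=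
  norm_le_of_sqVar_le (norm_nonneg x) fun n _ hp => sqVar_max_le x N n hp

lemma tendsto_norm_flatten (x : JamesSpace) :
    Tendsto (fun N => ‖flatten N x‖) atTop (𝓝 0) := by
  rw [Metric.tendsto_atTop]
  intro ε hε
  obtain ⟨N, hN⟩ := exists_sqVar_le x.bddAbove_seq (pow_pos (half_pos hε) 2)
  refine ⟨N, fun M hM => ?_⟩
  have : ‖flatten M x‖ ≤ ε / 2 := norm_le_of_sqVar_le (half_pos hε).le fun n p hp =>
    hN n (fun j => max (p j) M) (fun _ _ h => max_le_max (hp.monotone h) le_rfl)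
      (hM.trans (le_max_right _ _))
  rw [dist_zero_right, norm_norm]
  linarith

/-- The part of `x` after the index `N`. -/
noncomputable def tail (N : ℕ) (x : JamesSpace) : JamesSpace :=
  flatten (N + 1) x - x.seq (N + 1) • step N

lemma seq_tail (N : ℕ) (x : JamesSpace) (i : ℕ) :
    (tail N x).seq i = if i ≤ N then 0 else x.seq i := by
  by_cases h : i ≤ N
  · have : max i (N + 1) = N + 1 := by omega
    simp [tail, h, this]
  · have : max i (N + 1) = i := by omega
    simp [tail, h, this]

lemma norm_tail_le_add (N : ℕ) (x : JamesSpace) :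
    ‖tail N x‖ ≤ ‖flatten (N + 1) x‖ + |x.seq (N + 1)| := by
  refine (norm_sub_le _ _).trans (add_le_add le_rfl ?_)
  rw [norm_smul, Real.norm_eq_abs]
  exact mul_le_of_le_one_right (abs_nonneg _) (norm_step_le N)

lemma norm_tail_le (N : ℕ) (x : JamesSpace) : ‖tail N x‖ ≤ 2 * ‖x‖ := by
  have h1 := norm_tail_le_add N x
  have h2 := norm_flatten_le (N + 1) x
  have h3 := abs_seq_le_norm x (N + 1)
  linarith

lemma tendsto_norm_tail (x : JamesSpace) : Tendsto (fun N => ‖tail N x‖) atTop (𝓝 0) := by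
  refine squeeze_zero (fun _ => norm_nonneg _) (fun N => norm_tail_le_add N x) ?_
  have h1 := (tendsto_norm_flatten x).comp (tendsto_add_atTop_nat 1)
  have h2 := (x.tendsto_seq.comp (tendsto_add_atTop_nat 1)).abs
  simpa using h1.add h2

/-- Disjointly supported elements of `J` satisfy an upper `ℓ²` estimate. -/
lemma norm_sum_sq_le {ι : Type*} (F : Finset ι) (u : ι → JamesSpace)
    (h : ∀ i, ∀ k ∈ F, ∀ l ∈ F, (u k).seq i ≠ 0 → (u l).seq i ≠ 0 → k = l) :
    ‖∑ k ∈ F, u k‖ ^ 2 ≤ 2 * ∑ k ∈ F, ‖u k‖ ^ 2 := by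
  classical
  have hC : 0 ≤ 2 * ∑ k ∈ F, ‖u k‖ ^ 2 :=
    mul_nonneg zero_le_two (Finset.sum_nonneg fun _ _ => sq_nonneg _)
  have hcard : ∀ i, (F.filter fun k => (u k).seq i ≠ 0).card ≤ 1 := fun i =>
    Finset.card_le_one.2 fun k hk l hl => by
      rw [Finset.mem_filter] at hk hl
      exact h i k hk.1 l hl.1 hk.2 hl.2
  have key : ∀ a b, |∑ k ∈ F, (u k).seq b - ∑ k ∈ F, (u k).seq a| ^ 2 ≤
      2 * ∑ k ∈ F, |(u k).seq b - (u k).seq a| ^ 2 := fun a b => by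
    -- At most one `u k` is nonzero at `a` and at most one at `b`, so a single jump of the sum
    -- involves two vectors at most. Cauchy–Schwarz over two terms gives the factor 2.
    set G := (F.filter fun k => (u k).seq a ≠ 0) ∪ (F.filter fun k => (u k).seq b ≠ 0) with hG
    have hGF : G ⊆ F := Finset.union_subset (Finset.filter_subset _ _) (Finset.filter_subset _ _)
    have hGc : (G.card : ℝ) ≤ 2 := by
      have := (Finset.card_union_le _ _).trans (add_le_add (hcard a) (hcard b))
      exact_mod_cast this
    have h0 : ∀ k ∈ F, k ∉ G → (u k).seq b - (u k).seq a = 0 := fun k hk hkG => by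
      simp only [hG, Finset.mem_union, Finset.mem_filter, hk, true_and, not_or, not_not] at hkG
      rw [hkG.1, hkG.2, sub_zero]
    rw [← Finset.sum_sub_distrib, ← Finset.sum_subset hGF h0, sq_abs]
    refine sq_sum_le_card_mul_sum_sq.trans ?_
    simp only [sq_abs]
    exact mul_le_mul hGc (Finset.sum_le_sum_of_subset_of_nonneg hGF fun _ _ _ => sq_nonneg _)
      (Finset.sum_nonneg fun _ _ => sq_nonneg _) zero_le_two
  have : ‖∑ k ∈ F, u k‖ ≤ √(2 * ∑ k ∈ F, ‖u k‖ ^ 2) := by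
    refine norm_le_of_sqVar_le (Real.sqrt_nonneg _) fun n p hp => ?_
    rw [Real.sq_sqrt hC]
    calc sqVar (∑ k ∈ F, u k).seq n p
        ≤ ∑ j ∈ Finset.range n, 2 * ∑ k ∈ F, |(u k).seq (p (j + 1)) - (u k).seq (p j)| ^ 2 := by
          refine Finset.sum_le_sum fun j _ => ?_
          rw [seq_sum, seq_sum]
          exact key _ _
      _ = 2 * ∑ k ∈ F, sqVar (u k).seq n p := by
          rw [← Finset.mul_sum, Finset.sum_comm]
          rfl
      _ ≤ _ := mul_le_mul_of_nonneg_left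
          (Finset.sum_le_sum fun k _ => sqVar_le_norm_sq (u k) n hp.monotone) zero_le_two
  calc ‖∑ k ∈ F, u k‖ ^ 2 ≤ √(2 * ∑ k ∈ F, ‖u k‖ ^ 2) ^ 2 :=
        pow_le_pow_left₀ (norm_nonneg _) this 2
    _ = _ := Real.sq_sqrt hC

end James

namespace James

/-! ### The basis of `J` is shrinking -/

lemma eq_of_mem_blocks {p : ℕ → ℕ} (hp : Monotone p) {k l i : ℕ} (hk : p k ≤ i)
    (hk' : i < p (k + 1)) (hl : p l ≤ i) (hl' : i < p (l + 1)) : k = l := by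
  rcases lt_trichotomy k l with h | h | h
  · exact absurd (hp (Nat.succ_le_of_lt h)) (by simp only [Nat.succ_eq_add_one]; omega)
  · exact h
  · exact absurd (hp (Nat.succ_le_of_lt h)) (by simp only [Nat.succ_eq_add_one]; omega)

lemma norm_sum_blocks_sq_le {p : ℕ → ℕ} (hp : Monotone p) (F : Finset ℕ) (u : ℕ → JamesSpace)
    (hu : ∀ k ∈ F, ∀ i, (u k).seq i ≠ 0 → p k ≤ i ∧ i < p (k + 1)) {C : ℝ}
    (hC : ∀ k ∈ F, ‖u k‖ ≤ C) : ‖∑ k ∈ F, u k‖ ^ 2 ≤ 2 * (F.card * C ^ 2) := by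
  refine (norm_sum_sq_le F u fun i k hk l hl h1 h2 => ?_).trans ?_
  · have a := hu k hk i h1
    have b := hu l hl i h2
    exact eq_of_mem_blocks hp a.1 a.2 b.1 b.2
  · refine mul_le_mul_of_nonneg_left ?_ zero_le_two
    rw [← nsmul_eq_mul]
    exact Finset.sum_le_card_nsmul _ _ _ fun k hk =>
      pow_le_pow_left₀ (norm_nonneg _) (hC k hk) 2

/-- A functional on `J` which is at least `c` on each of many normalized blocks has large norm. -/
lemma card_mul_sq_le {p : ℕ → ℕ} (hp : Monotone p) (F : Finset ℕ) (u : ℕ → JamesSpace)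
    (hu : ∀ k ∈ F, ∀ i, (u k).seq i ≠ 0 → p k ≤ i ∧ i < p (k + 1)) {C c : ℝ} (hc : 0 < c)
    (hC : ∀ k ∈ F, ‖u k‖ ≤ C) (φ : JamesDual) (hφ : ∀ k ∈ F, c ≤ φ (u k)) :
    F.card * c ^ 2 ≤ 2 * ‖φ‖ ^ 2 * C ^ 2 := by
  rcases F.eq_empty_or_nonempty with rfl | hF
  · simp only [Finset.card_empty, Nat.cast_zero, zero_mul]
    positivity
  have hm : (0 : ℝ) < F.card := by exact_mod_cast hF.card_pos
  have h1 : F.card * c ≤ ‖φ‖ * ‖∑ k ∈ F, u k‖ := by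
    refine le_trans ?_ ((le_abs_self _).trans (φ.le_opNorm _))
    rw [map_sum, ← nsmul_eq_mul]
    exact Finset.card_nsmul_le_sum _ _ _ hφ
  have h2 : (F.card * c) ^ 2 ≤ (‖φ‖ * ‖∑ k ∈ F, u k‖) ^ 2 :=
    pow_le_pow_left₀ (by positivity) h1 2
  have h3 : ‖φ‖ ^ 2 * ‖∑ k ∈ F, u k‖ ^ 2 ≤ ‖φ‖ ^ 2 * (2 * (F.card * C ^ 2)) :=
    mul_le_mul_of_nonneg_left (norm_sum_blocks_sq_le hp F u hu hC) (sq_nonneg _)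
  refine le_of_mul_le_mul_left ?_ hm
  calc (F.card : ℝ) * (F.card * c ^ 2) = (F.card * c) ^ 2 := by ring
    _ ≤ ‖φ‖ ^ 2 * ‖∑ k ∈ F, u k‖ ^ 2 := by rw [← mul_pow]; exact h2
    _ ≤ _ := h3
    _ = _ := by ring

/-- The unit vector basis of `J` is shrinking. -/
lemma exists_abs_apply_le (φ : JamesDual) {δ : ℝ} (hδ : 0 < δ) :
    ∃ N, ∀ u : JamesSpace, (∀ i < N, u.seq i = 0) → |φ u| ≤ δ * ‖u‖ := by
  by_contra! hcon
  -- If the claim fails, every tail contains a finitely supported `v` of bounded norm on which `φ`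
  -- is at least `1 / 2`: normalize a bad vector to `φ w = 1` and cut off a tail on which `φ` is at
  -- most `1 / 2`. Iterating yields arbitrarily many disjoint blocks, contradicting
  -- `card_mul_sq_le`.
  have key : ∀ N, ∃ M v, N ≤ M ∧ (∀ i, v.seq i ≠ 0 → N ≤ i ∧ i < M) ∧ ‖v‖ ≤ 3 / δ ∧
      1 / 2 ≤ φ v := by
    intro N
    obtain ⟨u, hu, hφu⟩ := hcon N
    have hpos : 0 < |φ u| := (mul_nonneg hδ.le (norm_nonneg u)).trans_lt hφu
    have hne : φ u ≠ 0 := abs_pos.1 hpos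
    set w := (φ u)⁻¹ • u with hw
    have hφw : φ w = 1 := by rw [hw, map_smul, smul_eq_mul, inv_mul_cancel₀ hne]
    have hwn : ‖w‖ ≤ 1 / δ := by
      rw [hw, norm_smul, norm_inv, Real.norm_eq_abs, inv_mul_eq_div, div_le_div_iff₀ hpos hδ]
      linarith
    have h0 : Tendsto (fun M => ‖φ‖ * ‖tail M w‖) atTop (𝓝 0) := by
      simpa using (tendsto_norm_tail w).const_mul ‖φ‖
    obtain ⟨M, hM1, hM2⟩ := ((h0.eventually (ge_mem_nhds (by norm_num : (0 : ℝ) < 1 / 2))).and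
      (eventually_ge_atTop N)).exists
    refine ⟨M + 1, w - tail M w, by omega, fun i hi => ?_, ?_, ?_⟩
    · rw [seq_sub, seq_tail] at hi
      by_cases hiM : i ≤ M
      · refine ⟨not_lt.1 fun h => hi ?_, by omega⟩
        simp [hiM, hw, hu i h]
      · simp [hiM] at hi
    · have h1 := norm_sub_le w (tail M w)
      have h2 := norm_tail_le M w
      have h3 : 3 / δ = 3 * (1 / δ) := by ring
      linarith
    · have h1 := (le_abs_self _).trans (φ.le_opNorm (tail M w))
      rw [map_sub, hφw]
      linarith
  choose M v hM hv hvn hφv using key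
  set p : ℕ → ℕ := fun k => M^[k] 0 with hp
  have hps : ∀ k, p (k + 1) = M (p k) := fun k => Function.iterate_succ_apply' M k 0
  have hpm : Monotone p := monotone_nat_of_le_succ fun k => by rw [hps]; exact hM _
  obtain ⟨m, hm⟩ := exists_nat_gt (8 * ‖φ‖ ^ 2 * (3 / δ) ^ 2)
  have := card_mul_sq_le hpm (Finset.range m) (fun k => v (p k))
    (fun k _ i hi => by rw [hps]; exact hv _ i hi) one_half_pos (fun k _ => hvn _) φ
    (fun k _ => hφv _)
  rw [Finset.card_range] at this
  linarith

/-! ### The expansion in `J*` -/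

lemma norm_step_sub_le (s t : ℕ) : ‖step s - step t‖ ≤ 2 := by
  have h1 := norm_sub_le (step s) (step t)
  have h2 := norm_step_le s
  have h3 := norm_step_le t
  linarith

lemma cauchySeq_apply_step (φ : JamesDual) : CauchySeq fun s => φ (step s) := by
  rw [Metric.cauchySeq_iff]
  intro ε hε
  obtain ⟨N, hN⟩ := exists_abs_apply_le φ (by positivity : 0 < ε / 4)
  refine ⟨N, fun s hs t ht => ?_⟩
  have h := hN (step s - step t) fun i hi => by
    have h1 : i ≤ s := by omega
    have h2 : i ≤ t := by omega
    simp [h1, h2]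
  rw [map_sub] at h
  rw [Real.dist_eq]
  have h2 := mul_le_mul_of_nonneg_left (norm_step_sub_le s t) (by positivity : 0 ≤ ε / 4)
  linarith

/-- Pointwise limits of bounded functionals on the complete space `J*` are bounded, by
Banach–Steinhaus. -/
lemma exists_limitFunctional : ∃ L : StrongDual ℝ JamesDual,
    ∀ φ : JamesDual, Tendsto (fun s => φ (step s)) atTop (𝓝 (L φ)) := by
  choose f hf using fun φ : JamesDual => cauchySeq_tendsto_of_complete (cauchySeq_apply_step φ)
  exact ⟨continuousLinearMapOfTendsto
    (fun s => NormedSpace.inclusionInDoubleDual ℝ JamesSpace (step s)) (f := f)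
    (tendsto_pi_nhds.2 hf), hf⟩

/-- The coefficient of `S_∞*` in the expansion of an element of `J*`. -/
noncomputable def coeffInf : StrongDual ℝ JamesDual := exists_limitFunctional.choose

lemma tendsto_apply_step (φ : JamesDual) : Tendsto (fun s => φ (step s)) atTop (𝓝 (coeffInf φ)) :=
  exists_limitFunctional.choose_spec φ

lemma abs_apply_step_le (φ : JamesDual) (s : ℕ) : |φ (step s)| ≤ ‖φ‖ :=
  (φ.le_opNorm _).trans (mul_le_of_le_one_right (norm_nonneg _) (norm_step_le s))

lemma abs_coeffInf_le (φ : JamesDual) : |coeffInf φ| ≤ ‖φ‖ :=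
  le_of_tendsto (tendsto_apply_step φ).abs (Eventually.of_forall (abs_apply_step_le φ))

/-- The coefficient of `f_s*` in the expansion of an element of `J*`. -/
noncomputable def coeff (s : ℕ) : StrongDual ℝ JamesDual :=
  NormedSpace.inclusionInDoubleDual ℝ JamesSpace (step s) - coeffInf

lemma coeff_apply (s : ℕ) (φ : JamesDual) : coeff s φ = φ (step s) - coeffInf φ := rfl

lemma tendsto_coeff (φ : JamesDual) : Tendsto (fun s => coeff s φ) atTop (𝓝 0) := by
  simpa [coeff_apply] using (tendsto_apply_step φ).sub_const (coeffInf φ)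

@[simp] lemma fStar_apply (s : ℕ) (x : JamesSpace) : fStar s x = x.seq s - x.seq (s + 1) := rfl

@[simp] lemma sInftyStar_apply (x : JamesSpace) : sInftyStar x = x.seq 0 := rfl

lemma fStar_step (s t : ℕ) : fStar s (step t) = if s = t then 1 else 0 := by
  simp only [fStar_apply, seq_step]
  split_ifs <;> first | omega | norm_num

lemma sum_smul_step (x : JamesSpace) (N : ℕ) :
    ∑ s ∈ Finset.range N, (x.seq s - x.seq (s + 1)) • step s = x - flatten N x := by
  induction N with
  | zero =>
    refine JamesSpace.ext_seq fun i => ?_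
    simp
  | succ N ih =>
    rw [Finset.sum_range_succ, ih]
    refine JamesSpace.ext_seq fun i => ?_
    rcases lt_trichotomy i N with h | rfl | h
    · have h1 : max i N = N := by omega
      have h2 : max i (N + 1) = N + 1 := by omega
      simp [h2, h.le]
    · simp
    · have h1 : max i N = i := by omega
      have h2 : max i (N + 1) = i := by omega
      simp [h1, h2, not_le.2 h]

/-- After `K + 1` terms the remainder at `x` is `φ (tail K x) + x_{K+1} * coeff K φ`. The first term
is uniformly small since the basis is shrinking, the second since the coefficients tend to 0. -/
lemma isExpansion_coeff (φ : JamesDual) : IsExpansion φ (fun s => coeff s φ) (coeffInf φ) := by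
  rw [IsExpansion, Metric.tendsto_atTop]
  intro ε hε
  obtain ⟨N, hN⟩ := exists_abs_apply_le φ (by positivity : 0 < ε / 8)
  obtain ⟨M, hM⟩ := Metric.tendsto_atTop.1 (tendsto_coeff φ) (ε / 4) (by positivity)
  refine ⟨max N M + 1, fun K hK => ?_⟩
  obtain ⟨K, rfl⟩ : ∃ k, K = k + 1 := ⟨K - 1, by omega⟩
  rw [dist_comm, dist_eq_norm]
  refine lt_of_le_of_lt (ContinuousLinearMap.opNorm_le_bound _ (by positivity : 0 ≤ ε / 2)
    fun x => ?_) (half_lt_self hε)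
  have e : (φ - ((∑ s ∈ Finset.range (K + 1), coeff s φ • fStar s) + coeffInf φ • sInftyStar)) x =
      φ (tail K x) + x.seq (K + 1) * coeff K φ := by
    have h1 : ∑ s ∈ Finset.range (K + 1), coeff s φ * (x.seq s - x.seq (s + 1)) =
        φ (x - flatten (K + 1) x) - coeffInf φ * (x.seq 0 - x.seq (K + 1)) := by
      rw [← sum_smul_step, map_sum, ← Finset.sum_range_sub' x.seq, Finset.mul_sum,
        ← Finset.sum_sub_distrib]
      refine Finset.sum_congr rfl fun s _ => ?_
      rw [map_smul, coeff_apply, smul_eq_mul]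
      ring
    have h2 : φ (tail K x) = φ (flatten (K + 1) x) - x.seq (K + 1) * φ (step K) := by
      rw [tail, map_sub, map_smul, smul_eq_mul]
    simp only [sub_apply, add_apply, sum_apply, smul_apply, smul_eq_mul, fStar_apply,
      sInftyStar_apply]
    rw [h1, h2, coeff_apply, map_sub]
    ring
  rw [e, Real.norm_eq_abs]
  have h1 := hN (tail K x) fun i hi => by
    have : i ≤ K := by omega
    simp [seq_tail, this]
  have h2 := mul_le_mul_of_nonneg_left (norm_tail_le K x) (by positivity : 0 ≤ ε / 8)
  have h3 : |coeff K φ| ≤ ε / 4 := by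
    have := hM K (by omega)
    rw [Real.dist_0_eq_abs] at this
    exact this.le
  have h4 := mul_le_mul (abs_seq_le_norm x (K + 1)) h3 (abs_nonneg _) (norm_nonneg x)
  have h5 := abs_add_le (φ (tail K x)) (x.seq (K + 1) * coeff K φ)
  rw [abs_mul] at h5
  linarith

/-- Evaluation at `step t` gives `a t + aInf`. Convergence forces `‖a N • fStar N‖ → 0`, hence `a →
0`, so `aInf` is the limit of `φ (step t)`. -/
lemma IsExpansion.unique {φ : JamesDual} {a : ℕ → ℝ} {aInf : ℝ} (h : IsExpansion φ a aInf) :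
    a = (fun s => coeff s φ) ∧ aInf = coeffInf φ := by
  have hstep : ∀ t, φ (step t) = a t + aInf := fun t => by
    have h1 : Tendsto (fun N : ℕ => ((∑ s ∈ Finset.range N, a s • fStar s) + aInf • sInftyStar)
        (step t)) atTop (𝓝 (φ (step t))) :=
      ((NormedSpace.inclusionInDoubleDual ℝ JamesSpace (step t)).continuous.tendsto φ).comp h
    refine tendsto_nhds_unique h1 (tendsto_const_nhds.congr' ?_)
    filter_upwards [eventually_gt_atTop t] with N hN
    have hN' : ¬ N ≤ t := not_le.2 hN
    simp [-fStar_apply, fStar_step, hN']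
  have h0 : Tendsto a atTop (𝓝 0) := by
    have h1 : Tendsto (fun N : ℕ => ‖a N • fStar N‖) atTop (𝓝 0) := by
      have := ((h.comp (tendsto_add_atTop_nat 1)).sub h).norm
      rw [sub_self, norm_zero] at this
      refine this.congr fun N => ?_
      simp only [Function.comp, Finset.sum_range_succ]
      congr 1
      abel
    refine squeeze_zero_norm (fun N => ?_) h1
    have h2 := (a N • fStar N).le_opNorm (step N)
    rw [smul_apply, fStar_step, if_pos rfl, smul_eq_mul, mul_one] at h2
    exact h2.trans (mul_le_of_le_one_right (norm_nonneg _) (norm_step_le N))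
  have hInf : aInf = coeffInf φ := by
    refine tendsto_nhds_unique ?_ (tendsto_apply_step φ)
    simp only [hstep]
    simpa using h0.add_const aInf
  refine ⟨funext fun s => ?_, hInf⟩
  rw [coeff_apply, hstep, ← hInf]
  ring

lemma existsUnique_isExpansion (φ : JamesDual) :
    ∃! c : (ℕ → ℝ) × ℝ, IsExpansion φ c.1 c.2 :=
  ⟨(fun s => coeff s φ, coeffInf φ), isExpansion_coeff φ, fun _ hc =>
    Prod.ext hc.unique.1 hc.unique.2⟩

/-- Continuous linear functionals on `J*` are determined by their values at the coordinate
functionals. -/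
lemma ext_coord {ξ ζ : StrongDual ℝ JamesDual} (h : ∀ i, ξ (coord i) = ζ (coord i)) : ξ = ζ := by
  ext φ
  have h1 := (ξ.continuous.tendsto φ).comp (isExpansion_coeff φ)
  refine tendsto_nhds_unique h1
    (((ζ.continuous.tendsto φ).comp (isExpansion_coeff φ)).congr fun N => ?_)
  simp [fStar, sInftyStar, h]

end James

namespace James

/-! ### Averages of the basis -/

/-- The mean of `u_p, ..., u_{q-1}`. -/
noncomputable def intervalMean {E : Type*} [AddCommGroup E] [Module ℝ E] (u : ℕ → E) (p q : ℕ) :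
    E :=
  ∑ s ∈ Finset.Ico p q, ((q : ℝ) - p)⁻¹ • u s

section IntervalMean

variable {E F : Type*} [AddCommGroup E] [Module ℝ E] [AddCommGroup F] [Module ℝ F]

lemma sum_inv_Ico {p q : ℕ} (h : p < q) : ∑ _s ∈ Finset.Ico p q, ((q : ℝ) - p)⁻¹ = 1 := by
  have : ((q : ℝ) - p) ≠ 0 := sub_ne_zero.2 (by exact_mod_cast h.ne')
  rw [Finset.sum_const, Nat.card_Ico, nsmul_eq_mul, Nat.cast_sub h.le, mul_inv_cancel₀ this]

lemma intervalMean_mem {K : Set E} (hK : Convex ℝ K) {u : ℕ → E} {p q : ℕ} (h : p < q)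
    (hu : ∀ s, p ≤ s → s < q → u s ∈ K) : intervalMean u p q ∈ K := by
  refine hK.sum_mem (fun _ _ => ?_) (sum_inv_Ico h) fun s hs => ?_
  · exact inv_nonneg.2 (sub_nonneg.2 (by exact_mod_cast h.le))
  · exact hu s (Finset.mem_Ico.1 hs).1 (Finset.mem_Ico.1 hs).2

lemma map_intervalMean (f : E →ₗ[ℝ] F) (u : ℕ → E) (p q : ℕ) :
    f (intervalMean u p q) = intervalMean (fun s => f (u s)) p q := by
  simp [intervalMean]

lemma intervalMean_sub_const (a : ℕ → ℝ) (c : ℝ) {p q : ℕ} (h : p < q) :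
    intervalMean (fun s => a s - c) p q = intervalMean a p q - c := by
  have := sum_inv_Ico h
  simp only [intervalMean, smul_eq_mul, mul_sub, Finset.sum_sub_distrib, ← Finset.sum_mul, this,
    one_mul]

lemma blockAverage_eq (a : ℕ → ℝ) (p q : ℕ) : blockAverage a p q = intervalMean a p q := by
  rw [blockAverage, intervalMean, div_eq_inv_mul, Finset.mul_sum]
  rfl

lemma doubleAverage_eq (n : ℕ → ℕ) (a : ℕ → ℝ) (r r' : ℕ) :
    doubleAverage n a r r' = intervalMean (fun i => intervalMean a (n i) (n (i + 1))) r r' := by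
  simp only [doubleAverage, intervalMean, div_eq_inv_mul, Finset.mul_sum, blockAverage_eq,
    smul_eq_mul]

end IntervalMean

/-- The double average of the basis vectors `f_s`. -/
noncomputable def stepMean (n : ℕ → ℕ) (r r' : ℕ) : JamesSpace :=
  intervalMean (fun i => intervalMean step (n i) (n (i + 1))) r r'

lemma stepMean_mem {n : ℕ → ℕ} (hn : StrictMono n) {r r' : ℕ} (h : r < r') :
    stepMean n r r' ∈ convexHull ℝ (step '' Set.Ico (n r) (n r')) := by
  refine intervalMean_mem (convex_convexHull ℝ _) h fun i hi hi' => ?_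
  refine intervalMean_mem (convex_convexHull ℝ _) (hn i.lt_add_one) fun s hs hs' => ?_
  exact subset_convexHull ℝ _ ⟨s, ⟨(hn.monotone hi).trans hs,
    hs'.trans_le (hn.monotone hi')⟩, rfl⟩

/-- The functional `∑_s a_s f_s* + a_∞ S_∞* ↦ ∑_s c_s a_s` on `J*`, for a vector
`u = ∑_s c_s f_s` of `J` with `∑_s c_s = 1`. -/
noncomputable def meanFunctional (u : JamesSpace) : StrongDual ℝ JamesDual :=
  NormedSpace.inclusionInDoubleDual ℝ JamesSpace u - coeffInf

lemma meanFunctional_apply (u : JamesSpace) (φ : JamesDual) :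
    meanFunctional u φ = φ u - coeffInf φ := rfl

/-- The weights in each average sum to 1, so subtracting the constant `coeffInf φ` commutes with
both averages. -/
lemma meanFunctional_stepMean {n : ℕ → ℕ} (hn : StrictMono n) {r r' : ℕ} (h : r < r')
    (φ : JamesDual) :
    meanFunctional (stepMean n r r') φ = doubleAverage n (fun s => coeff s φ) r r' := by
  rw [meanFunctional_apply, stepMean, doubleAverage_eq]
  have e : ∀ i, intervalMean (fun s => coeff s φ) (n i) (n (i + 1)) =
      φ (intervalMean step (n i) (n (i + 1))) - coeffInf φ := fun i => by
    have := map_intervalMean φ.toLinearMap step (n i) (n (i + 1))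
    simp only [ContinuousLinearMap.coe_coe] at this
    rw [this, ← intervalMean_sub_const _ _ (hn i.lt_add_one)]
    rfl
  simp only [e]
  rw [intervalMean_sub_const _ _ h]
  congr 1
  exact map_intervalMean φ.toLinearMap _ r r'

/-! ### Interpolation operators on `J` -/

/-- The combination is a staircase dropping by `x_{p j} - x_{p (j+1)}` just after `s j`; telescoping
shows that it samples `x` at `ι i = p k`, where `k` counts the `j < N` with `s j < i`. The clause on
`ι` beyond `p N` is what the induction needs. -/
lemma exists_selection {p : ℕ → ℕ} (hp : Monotone p) (s : ℕ → ℕ) (N : ℕ)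
    (hs : ∀ j < N, p j ≤ s j ∧ s j < p (j + 1)) :
    ∃ ι : ℕ → ℕ, Monotone ι ∧ (∀ i, p N ≤ i → ι i = p N) ∧ ∀ (x : JamesSpace) (i : ℕ),
      (∑ j ∈ Finset.range N, (x.seq (p j) - x.seq (p (j + 1))) • step (s j)).seq i =
        x.seq (ι i) - x.seq (p N) := by
  induction N with
  | zero => exact ⟨fun _ => p 0, monotone_const, fun _ _ => rfl, fun x i => by simp⟩
  | succ N ih =>
    obtain ⟨ι, hι, hιN, hsum⟩ := ih fun j hj => hs j (by omega)
    obtain ⟨hs1, hs2⟩ := hs N N.lt_add_one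
    refine ⟨fun i => if i ≤ s N then ι i else p (N + 1), fun i i' h => ?_, fun i hi => ?_,
      fun x i => ?_⟩
    · by_cases h1 : i' ≤ s N
      · simp only [h1, h.trans h1, if_true]
        exact hι h
      · by_cases h2 : i ≤ s N
        · simp only [h1, h2, if_true, if_false]
          calc ι i ≤ ι (max i (p N)) := hι (le_max_left _ _)
            _ = p N := hιN _ (le_max_right _ _)
            _ ≤ _ := hp N.le_succ
        · simp [h1, h2]
    · simp [not_le.2 (hs2.trans_le hi)]
    · rw [Finset.sum_range_succ, seq_add, hsum, seq_smul, seq_step]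
      by_cases h : i ≤ s N
      · simp [h]
      · simp [h, hιN i (by omega)]

lemma norm_selection_le {p : ℕ → ℕ} (hp : Monotone p) (s : ℕ → ℕ) (N : ℕ)
    (hs : ∀ j < N, p j ≤ s j ∧ s j < p (j + 1)) (x : JamesSpace) :
    ‖∑ j ∈ Finset.range N, (x.seq (p j) - x.seq (p (j + 1))) • step (s j)‖ ≤ ‖x‖ := by
  obtain ⟨ι, hι, -, hsum⟩ := exists_selection hp s N hs
  refine norm_le_of_sqVar_le (norm_nonneg x) fun n q hq => ?_
  refine le_trans (le_of_eq ?_) (sqVar_le_norm_sq x n (hι.comp hq.monotone))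
  refine Finset.sum_congr rfl fun j _ => ?_
  rw [hsum, hsum]
  simp

open scoped Pointwise in
/-- Interpolating a sequence between its values at a subsequence does not increase the norm. -/
lemma norm_interpolation_le {p : ℕ → ℕ} (hp : Monotone p) {F : ℕ → JamesSpace} (N : ℕ)
    (hF : ∀ j, F j ∈ convexHull ℝ (step '' Set.Ico (p j) (p (j + 1)))) (x : JamesSpace) :
    ‖∑ j ∈ Finset.range N, (x.seq (p j) - x.seq (p (j + 1))) • F j‖ ≤ ‖x‖ := by
  -- The Minkowski sum of convex hulls is the hull of the Minkowski sum, so it suffices to put the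
  -- sums with one step chosen per block into the ball; these are the selections above.
  set c : ℕ → ℝ := fun j => x.seq (p j) - x.seq (p (j + 1)) with hc
  have hsub : (∑ j ∈ Finset.range N, (fun u => c j • u) '' (step '' Set.Ico (p j) (p (j + 1)))) ⊆
      Metric.closedBall (0 : JamesSpace) ‖x‖ := by
    intro y hy
    obtain ⟨g, hg, rfl⟩ := (Set.mem_finsetSum _ _ _).1 hy
    have : ∀ j, ∃ t, j ∈ Finset.range N → (p j ≤ t ∧ t < p (j + 1)) ∧ c j • step t = g j := by
      intro j
      by_cases hj : j ∈ Finset.range N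
      · obtain ⟨_, ⟨t, ht, rfl⟩, h⟩ := hg hj
        exact ⟨t, fun _ => ⟨ht, h⟩⟩
      · exact ⟨0, fun h => absurd h hj⟩
    choose s hs using this
    rw [mem_closedBall_zero_iff, ← Finset.sum_congr rfl fun j hj => (hs j hj).2]
    exact norm_selection_le hp s N (fun j hj => (hs j (Finset.mem_range.2 hj)).1) x
  have hmem : ∑ j ∈ Finset.range N, c j • F j ∈
      convexHull ℝ (∑ j ∈ Finset.range N,
        (fun u => c j • u) '' (step '' Set.Ico (p j) (p (j + 1)))) := by
    rw [convexHull_sum]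
    refine Set.finsetSum_mem_finsetSum _ _ _ fun j _ => ?_
    have := (IsLinearMap.isLinearMap_smul (R := ℝ) (M := JamesSpace) (c j)).image_convexHull
      (step '' Set.Ico (p j) (p (j + 1)))
    rw [← this]
    exact ⟨F j, hF j, rfl⟩
  exact mem_closedBall_zero_iff.1
    (convexHull_min hsub (convex_closedBall (0 : JamesSpace) ‖x‖) hmem)

lemma seq_of_mem_convexHull {p q : ℕ} {u : JamesSpace}
    (hu : u ∈ convexHull ℝ (step '' Set.Ico p q)) (i : ℕ) :
    (0 ≤ u.seq i ∧ u.seq i ≤ 1) ∧ (i ≤ p → u.seq i = 1) ∧ (q ≤ i → u.seq i = 0) := by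
  have hconv : Convex ℝ {u : JamesSpace |
      (0 ≤ u.seq i ∧ u.seq i ≤ 1) ∧ (i ≤ p → u.seq i = 1) ∧ (q ≤ i → u.seq i = 0)} := by
    rintro u ⟨⟨h1, h2⟩, h3, h4⟩ v ⟨⟨k1, k2⟩, k3, k4⟩ a b ha hb hab
    simp only [Set.mem_ofPred_eq, seq_add, seq_smul]
    refine ⟨⟨by positivity, ?_⟩, fun h => ?_, fun h => ?_⟩
    · nlinarith
    · rw [h3 h, k3 h, mul_one, mul_one, hab]
    · rw [h4 h, k4 h, mul_zero, mul_zero, add_zero]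
  refine convexHull_min ?_ hconv hu
  rintro _ ⟨s, hs, rfl⟩
  simp only [Set.mem_ofPred_eq, seq_step]
  refine ⟨by split_ifs <;> norm_num, fun h => if_pos (h.trans hs.1),
    fun h => if_neg (not_le.2 (hs.2.trans_le h))⟩

/-! ### The averaging operators on `J*` -/

@[simp] lemma intervalStar_eq {p q : ℕ} (h : p ≤ q) : intervalStar p q = coord p - coord q := by
  rw [intervalStar, ← neg_sub (coord q), ← Finset.sum_Ico_sub coord h, ← Finset.sum_neg_distrib]
  exact Finset.sum_congr rfl fun s _ => (neg_sub _ _).symm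

lemma norm_intervalStar_le {p q : ℕ} (h : p ≤ q) : ‖intervalStar p q‖ ≤ 2 := by
  rw [intervalStar_eq h]
  have := norm_sub_le (coord p) (coord q)
  have := norm_coord_le p
  have := norm_coord_le q
  linarith

lemma abs_seq_sub_le (x : JamesSpace) (i j : ℕ) : |x.seq i - x.seq j| ≤ 2 * ‖x‖ := by
  have h1 := abs_sub (x.seq i) (x.seq j)
  have h2 := abs_seq_le_norm x i
  have h3 := abs_seq_le_norm x j
  linarith

/-- Moves the partial sum from `J*` to the interpolation operator on `J`; the `coeffInf` parts
telescope into a single rank-one correction. -/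
lemma sum_meanFunctional_apply {p : ℕ → ℕ} (hp : Monotone p) (F : ℕ → JamesSpace) (N : ℕ)
    (φ : JamesDual) (x : JamesSpace) :
    (∑ j ∈ Finset.range N, meanFunctional (F j) φ • intervalStar (p j) (p (j + 1))) x =
      φ (∑ j ∈ Finset.range N, (x.seq (p j) - x.seq (p (j + 1))) • F j) -
        coeffInf φ * (x.seq (p 0) - x.seq (p N)) := by
  rw [sum_apply, map_sum, ← Finset.sum_range_sub' fun j => x.seq (p j), Finset.mul_sum,
    ← Finset.sum_sub_distrib]
  refine Finset.sum_congr rfl fun j _ => ?_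
  rw [smul_apply, intervalStar_eq (hp j.le_succ), sub_apply, coord_apply, coord_apply, map_smul,
    meanFunctional_apply, smul_eq_mul, smul_eq_mul]
  ring

lemma norm_sum_meanFunctional_le {p : ℕ → ℕ} (hp : Monotone p) {F : ℕ → JamesSpace}
    (hF : ∀ j, F j ∈ convexHull ℝ (step '' Set.Ico (p j) (p (j + 1)))) (N : ℕ) (φ : JamesDual) :
    ‖∑ j ∈ Finset.range N, meanFunctional (F j) φ • intervalStar (p j) (p (j + 1))‖ ≤
      3 * ‖φ‖ := by
  refine ContinuousLinearMap.opNorm_le_bound _ (by positivity) fun x => ?_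
  rw [sum_meanFunctional_apply hp, Real.norm_eq_abs]
  refine (abs_sub _ _).trans ?_
  rw [abs_mul]
  have h1 := φ.le_opNorm_of_le (norm_interpolation_le hp N hF x)
  rw [Real.norm_eq_abs] at h1
  have h2 := mul_le_mul (abs_coeffInf_le φ) (abs_seq_sub_le x (p 0) (p N)) (abs_nonneg _)
    (norm_nonneg _)
  linarith

/-- The sum of the operators far out is small at each functional. -/
lemma norm_sum_meanFunctional_le_of_tail {p : ℕ → ℕ} (hp : Monotone p) {F : ℕ → JamesSpace}
    (hF : ∀ j, F j ∈ convexHull ℝ (step '' Set.Ico (p j) (p (j + 1)))) (N : ℕ) {φ : JamesDual}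
    {δ : ℝ} (hδ : 0 ≤ δ) (hφ : ∀ u : JamesSpace, (∀ i < p 0, u.seq i = 0) → |φ u| ≤ δ * ‖u‖)
    (hφ' : |coeff (p 0) φ| ≤ δ) :
    ‖∑ j ∈ Finset.range N, meanFunctional (F j) φ • intervalStar (p j) (p (j + 1))‖ ≤
      5 * δ := by
  refine ContinuousLinearMap.opNorm_le_bound _ (by positivity) fun x => ?_
  rw [sum_meanFunctional_apply hp, Real.norm_eq_abs]
  set T := ∑ j ∈ Finset.range N, (x.seq (p j) - x.seq (p (j + 1))) • F j with hT
  set d := x.seq (p 0) - x.seq (p N) with hd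
  -- `T` equals `d` before `p 0`, so subtracting `d • step (p 0)` leaves a vector on which `φ` is
  -- small. That vector costs `3 * δ` and the coefficient term `2 * δ`.
  have e : φ T - coeffInf φ * d = φ (T - d • step (p 0)) + d * coeff (p 0) φ := by
    rw [coeff_apply, map_sub, map_smul, smul_eq_mul]
    ring
  have h1 := hφ (T - d • step (p 0)) fun i hi => by
    rw [seq_sub, seq_smul, seq_step, if_pos hi.le, hT, seq_sum, hd, mul_one,
      ← Finset.sum_range_sub' fun j => x.seq (p j), sub_eq_zero]
    refine Finset.sum_congr rfl fun j _ => ?_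
    rw [seq_smul, (seq_of_mem_convexHull (hF j) i).2.1 (hi.le.trans (hp (Nat.zero_le j))), mul_one]
  have h2 : ‖T - d • step (p 0)‖ ≤ 3 * ‖x‖ := by
    refine (norm_sub_le _ _).trans ?_
    rw [norm_smul, Real.norm_eq_abs]
    have := norm_interpolation_le hp N hF x
    have := mul_le_mul (abs_seq_sub_le x (p 0) (p N)) (norm_step_le (p 0)) (norm_nonneg _)
      (by positivity)
    linarith
  have h3 := mul_le_mul_of_nonneg_left h2 hδ
  have h4 := mul_le_mul (abs_seq_sub_le x (p 0) (p N)) hφ' (abs_nonneg _) (by positivity)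
  rw [e]
  refine (abs_add_le _ _).trans ?_
  rw [abs_mul]
  linarith

lemma cauchySeq_sum_meanFunctional {p : ℕ → ℕ} (hp : StrictMono p) {F : ℕ → JamesSpace}
    (hF : ∀ j, F j ∈ convexHull ℝ (step '' Set.Ico (p j) (p (j + 1)))) (φ : JamesDual) :
    CauchySeq fun N => ∑ j ∈ Finset.range N,
      meanFunctional (F j) φ • intervalStar (p j) (p (j + 1)) := by
  refine Metric.cauchySeq_iff'.2 fun ε hε => ?_
  obtain ⟨N, hN⟩ := exists_abs_apply_le φ (by positivity : 0 < ε / 10)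
  obtain ⟨M, hM⟩ := Metric.tendsto_atTop.1 (tendsto_coeff φ) (ε / 10) (by positivity)
  refine ⟨max N M, fun K hK => ?_⟩
  obtain ⟨k, rfl⟩ := Nat.exists_eq_add_of_le hK
  have hle := hp.le_apply (x := max N M)
  rw [dist_eq_norm, Finset.sum_range_add, add_sub_cancel_left]
  have := norm_sum_meanFunctional_le_of_tail (p := fun j => p (max N M + j))
    (fun _ _ h => hp.monotone (by omega)) (F := fun j => F (max N M + j)) (fun j => hF _) k
    (φ := φ) (δ := ε / 10) (by positivity)
    (fun u hu => hN u fun i hi => hu i (by simp only [add_zero]; omega))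
    (by
      have := hM (p (max N M)) (by omega)
      rw [Real.dist_0_eq_abs] at this
      exact this.le)
  refine this.trans_lt ?_
  linarith

lemma exists_limit_operator {p : ℕ → ℕ} (hp : StrictMono p) {F : ℕ → JamesSpace}
    (hF : ∀ j, F j ∈ convexHull ℝ (step '' Set.Ico (p j) (p (j + 1)))) :
    ∃ U : JamesDual →L[ℝ] JamesDual,
      (∀ φ, Tendsto (fun N => ∑ j ∈ Finset.range N,
        meanFunctional (F j) φ • intervalStar (p j) (p (j + 1))) atTop (𝓝 (U φ))) ∧
      ∀ φ, ‖U φ‖ ≤ 3 * ‖φ‖ := by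
  choose f hf using fun φ => cauchySeq_tendsto_of_complete (cauchySeq_sum_meanFunctional hp hF φ)
  have hf' : Tendsto (fun N φ => (∑ j ∈ Finset.range N,
      (meanFunctional (F j)).smulRight (intervalStar (p j) (p (j + 1)))) φ) atTop (𝓝 f) :=
    tendsto_pi_nhds.2 fun φ => (hf φ).congr fun N => by simp [-intervalStar_eq]
  exact ⟨continuousLinearMapOfTendsto (fun N => ∑ j ∈ Finset.range N,
      (meanFunctional (F j)).smulRight (intervalStar (p j) (p (j + 1)))) hf', hf, fun φ =>
    le_of_tendsto (hf φ).norm (Eventually.of_forall fun N =>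
      norm_sum_meanFunctional_le hp.monotone hF N φ)⟩

/-! ### Weak compactness -/

/-- The coefficients of an element of `J**` have finite square variation. -/
lemma bddAbove_sqVarSet_coord (ξ : StrongDual ℝ JamesDual) :
    BddAbove (sqVarSet fun i => ξ (coord i)) := by
  refine bddAbove_of_sqVar_le (C := ‖ξ‖ ^ 2) fun n p hp => ?_
  set S := sqVar (fun i => ξ (coord i)) n p with hS
  have hS0 : 0 ≤ S := sqVar_nonneg _ _ _
  set d : ℕ → ℝ := fun j => ξ (coord (p (j + 1))) - ξ (coord (p j)) with hd
  have hSd : S = ∑ j ∈ Finset.range n, d j ^ 2 := by simp [hS, sqVar, hd]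
  -- Duality with the differences themselves as weights: `ξ ψ = S`, while Cauchy–Schwarz gives `‖ψ‖
  -- ≤ √S`, hence `√S ≤ ‖ξ‖`.
  set ψ : JamesDual := ∑ j ∈ Finset.range n, d j • (coord (p (j + 1)) - coord (p j)) with hψ
  have h1 : ξ ψ = S := by
    rw [hSd, hψ, map_sum]
    refine Finset.sum_congr rfl fun j _ => ?_
    rw [map_smul, map_sub, smul_eq_mul, sq]
  have h2 : ‖ψ‖ ≤ √S := by
    refine ContinuousLinearMap.opNorm_le_bound _ (Real.sqrt_nonneg _) fun x => ?_
    have hx : √(sqVar x.seq n p) ≤ ‖x‖ := sqrt_sqVar_le x.bddAbove_seq n hp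
    refine le_trans ?_ (mul_le_mul_of_nonneg_left hx (Real.sqrt_nonneg _))
    rw [← Real.sqrt_mul hS0, Real.norm_eq_abs]
    refine Real.abs_le_sqrt ?_
    have hψx : ψ x = ∑ j ∈ Finset.range n, d j * (x.seq (p (j + 1)) - x.seq (p j)) := by
      simp [hψ, sum_apply]
    rw [hψx, hSd]
    simp only [sqVar, sq_abs]
    exact Finset.sum_mul_sq_le_sq_mul_sq _ _ _
  have h3 : S ≤ ‖ξ‖ * √S := by
    calc S = ξ ψ := h1.symm
      _ ≤ ‖ξ‖ * ‖ψ‖ := (le_abs_self _).trans (ξ.le_opNorm _)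
      _ ≤ _ := mul_le_mul_of_nonneg_left h2 ξ.opNorm_nonneg
  have h4 := Real.sq_sqrt hS0
  have h5 := Real.sqrt_nonneg S
  rcases h5.eq_or_lt with h | h
  · rw [← h4, ← h, zero_pow two_ne_zero]
    exact sq_nonneg _
  · have : √S ≤ ‖ξ‖ := by nlinarith
    rw [← h4]
    exact pow_le_pow_left₀ h5 this 2

lemma coeffInf_coord (i : ℕ) : coeffInf (coord i) = 1 := by
  refine tendsto_nhds_unique (tendsto_apply_step _) (tendsto_const_nhds.congr' ?_)
  filter_upwards [eventually_ge_atTop i] with s hs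
  simp [hs]

/-- `B_j (coord i)` is `(F j).seq i - 1`: this is `-1` on blocks before the one containing `i`,
where the sum telescopes, and `0` on blocks after it. Only block `k` contributes a fractional term.
-/
lemma limit_operator_coord {p : ℕ → ℕ} (hp : StrictMono p) (hp0 : p 0 = 0) {F : ℕ → JamesSpace}
    (hF : ∀ j, F j ∈ convexHull ℝ (step '' Set.Ico (p j) (p (j + 1))))
    {U : JamesDual →L[ℝ] JamesDual}
    (hU : ∀ φ, Tendsto (fun N => ∑ j ∈ Finset.range N,
      meanFunctional (F j) φ • intervalStar (p j) (p (j + 1))) atTop (𝓝 (U φ)))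
    {i k : ℕ} (hk : p k ≤ i) (hk' : i < p (k + 1)) :
    U (coord i) = coord (p k) - coord 0 +
      ((F k).seq i - 1) • (coord (p k) - coord (p (k + 1))) := by
  refine tendsto_nhds_unique (hU (coord i)) (tendsto_const_nhds.congr' ?_)
  filter_upwards [eventually_gt_atTop k] with N hN
  have hB : ∀ j, meanFunctional (F j) (coord i) = (F j).seq i - 1 := fun j => by
    rw [meanFunctional_apply, coeffInf_coord, coord_apply]
  obtain ⟨m, rfl⟩ := Nat.exists_eq_add_of_le (Nat.succ_le_of_lt hN)
  rw [Finset.sum_range_add, Finset.sum_range_succ]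
  have e1 : ∑ j ∈ Finset.range k, meanFunctional (F j) (coord i) • intervalStar (p j) (p (j + 1)) =
      coord (p k) - coord 0 := by
    rw [← hp0, ← Finset.sum_range_sub fun j => coord (p j)]
    refine Finset.sum_congr rfl fun j hj => ?_
    have hj' : p (j + 1) ≤ i := (hp.monotone (Finset.mem_range.1 hj)).trans hk
    rw [hB, (seq_of_mem_convexHull (hF j) i).2.2 hj', intervalStar_eq (hp.monotone j.le_succ)]
    refine ContinuousLinearMap.ext fun x => ?_
    rw [smul_apply, sub_apply, sub_apply, smul_eq_mul]
    ring
  have e2 : ∑ j ∈ Finset.range m, meanFunctional (F (k.succ + j)) (coord i) •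
      intervalStar (p (k.succ + j)) (p (k.succ + j + 1)) = 0 := by
    refine Finset.sum_eq_zero fun j _ => ?_
    have hj' : i ≤ p (k.succ + j) := hk'.le.trans (hp.monotone (by omega))
    rw [hB, (seq_of_mem_convexHull (hF _) i).2.1 hj', sub_self, zero_smul]
  rw [e1, e2, add_zero, hB, intervalStar_eq (hp.monotone k.le_succ)]

lemma exists_block {p : ℕ → ℕ} (hp : StrictMono p) (hp0 : p 0 = 0) (i : ℕ) :
    ∃ k, p k ≤ i ∧ i < p (k + 1) := by
  have h : ∃ k, i < p (k + 1) := ⟨i, lt_of_lt_of_le i.lt_succ_self (hp.le_apply)⟩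
  classical
  refine ⟨Nat.find h, ?_, Nat.find_spec h⟩
  rcases Nat.eq_zero_or_pos (Nat.find h) with h0 | h0
  · rw [h0, hp0]
    exact Nat.zero_le _
  · have := Nat.find_min h (Nat.sub_lt h0 one_pos)
    rwa [not_lt, show Nat.find h - 1 + 1 = Nat.find h by omega] at this

/-- The adjoint of the operator maps `J**` into `J`, up to an operator of rank one. -/
lemma exists_predual {p : ℕ → ℕ} (hp : StrictMono p) (hp0 : p 0 = 0) {F : ℕ → JamesSpace}
    (hF : ∀ j, F j ∈ convexHull ℝ (step '' Set.Ico (p j) (p (j + 1))))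
    {U : JamesDual →L[ℝ] JamesDual}
    (hU : ∀ φ, Tendsto (fun N => ∑ j ∈ Finset.range N,
      meanFunctional (F j) φ • intervalStar (p j) (p (j + 1))) atTop (𝓝 (U φ)))
    (ξ : StrongDual ℝ JamesDual) :
    ∃ z : JamesSpace, ∀ φ : JamesDual, ξ (φ - U φ - coeffInf φ • sInftyStar) = φ z := by
  set W : JamesDual →L[ℝ] JamesDual :=
    ContinuousLinearMap.id ℝ JamesDual - U - coeffInf.smulRight sInftyStar with hW
  have h0 : Tendsto (fun i => (ξ.comp W) (coord i)) atTop (𝓝 0) := by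
    rw [Metric.tendsto_atTop]
    intro ε hε
    obtain ⟨N, hN⟩ := cauchySeq_of_bddAbove (bddAbove_sqVarSet_coord ξ)
      (by positivity : 0 < ε / 4)
    refine ⟨p N, fun i hi => ?_⟩
    obtain ⟨k, hk, hk'⟩ := exists_block hp hp0 i
    have hNk : N ≤ k := by
      by_contra h
      have := hp.monotone (show k + 1 ≤ N by omega)
      omega
    have hpk : N ≤ p k := hNk.trans hp.le_apply
    have hpk' : N ≤ p (k + 1) := hpk.trans (hp.monotone k.le_succ)
    -- The rank-one term cancels `coord 0`, leaving only differences of `ξ (coord ·)` within block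
    -- `k`, which are small by the Cauchy property.
    have e : (ξ.comp W) (coord i) = (ξ (coord i) - ξ (coord (p k))) -
        ((F k).seq i - 1) * (ξ (coord (p k)) - ξ (coord (p (k + 1)))) := by
      simp only [hW, ContinuousLinearMap.comp_apply, sub_apply, ContinuousLinearMap.id_apply,
        ContinuousLinearMap.smulRight_apply, coeffInf_coord,
        limit_operator_coord hp hp0 hF hU hk hk', map_sub, map_add, map_smul, smul_eq_mul,
        sInftyStar]
      ring
    have h1 := hN (p k) i hpk (hpk.trans hk)
    have h2 := hN (p (k + 1)) (p k) hpk' hpk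
    obtain ⟨⟨h3, h4⟩, -⟩ := seq_of_mem_convexHull (hF k) i
    have h5 : |(F k).seq i - 1| ≤ 1 := abs_le.2 ⟨by linarith, by linarith⟩
    have h6 := mul_le_mul h5 h2 (abs_nonneg _) zero_le_one
    rw [Real.dist_0_eq_abs, e]
    refine (abs_sub _ _).trans_lt ?_
    rw [abs_mul]
    linarith
  refine ⟨JamesSpace.mk _ h0 (bddAbove_sqVarSet_coord (ξ.comp W)), fun φ => ?_⟩
  exact DFunLike.congr_fun (ext_coord (ξ := ξ.comp W)
    (ζ := NormedSpace.inclusionInDoubleDual ℝ JamesSpace (JamesSpace.mk _ h0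
      (bddAbove_sqVarSet_coord (ξ.comp W)))) fun i => rfl) φ

end James

/-! ### Weak compactness in general normed spaces -/

lemma continuous_apply_weakSpace {E : Type*} [NormedAddCommGroup E] [NormedSpace ℝ E]
    (ξ : StrongDual ℝ E) : Continuous fun w : WeakSpace ℝ E => ξ ((toWeakSpace ℝ E).symm w) :=
  WeakBilin.eval_continuous (topDualPairing ℝ E).flip ξ

/-- An operator on a dual space is weakly compact if, up to an operator of rank one, its adjoint
maps the second dual into the predual. -/
lemma isWeaklyCompactOperator_of_predual {E : Type*} [NormedAddCommGroup E] [NormedSpace ℝ E]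
    (V : StrongDual ℝ E →L[ℝ] StrongDual ℝ E) (L : StrongDual ℝ (StrongDual ℝ E))
    (S : StrongDual ℝ E)
    (h : ∀ ξ : StrongDual ℝ (StrongDual ℝ E), ∃ z : E, ∀ φ, ξ (V φ - L φ • S) = φ z) :
    IsWeaklyCompactOperator V := by
  -- `L` need not be weak-* continuous, so its value becomes an independent parameter in a compact
  -- interval; the remaining part of `V` is weak-*-to-weak continuous by hypothesis.
  set G : WeakDual ℝ E × ℝ → WeakSpace ℝ (StrongDual ℝ E) := fun y =>
    toWeakSpace ℝ (StrongDual ℝ E) (V (WeakDual.toStrongDual y.1) -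
      L (WeakDual.toStrongDual y.1) • S + y.2 • S) with hG
  have hGc : Continuous G := by
    refine WeakBilin.continuous_of_continuous_eval _ fun ξ => ?_
    obtain ⟨z, hz⟩ := h ξ
    have : Continuous fun y : WeakDual ℝ E × ℝ => y.1 z + y.2 * ξ S :=
      ((WeakDual.eval_continuous z).comp continuous_fst).add (continuous_snd.mul continuous_const)
    refine this.congr fun y => ?_
    change _ = ξ (V (WeakDual.toStrongDual y.1) - L (WeakDual.toStrongDual y.1) • S + y.2 • S)
    rw [map_add, hz, map_smul, smul_eq_mul]
    rfl
  have hK : IsCompact (G '' ((WeakDual.toStrongDual ⁻¹' Metric.closedBall (0 : StrongDual ℝ E) 1) ×ˢ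
      Set.Icc (-‖L‖) ‖L‖)) :=
    ((WeakDual.isCompact_closedBall (𝕜 := ℝ) (E := E) 0 1).prod isCompact_Icc).image hGc
  refine hK.closure_of_subset ?_
  rintro _ ⟨_, ⟨φ, hφ, rfl⟩, rfl⟩
  refine ⟨(StrongDual.toWeakDual φ, L φ), ⟨hφ, ?_⟩, ?_⟩
  · have h1 := L.le_opNorm φ
    rw [Real.norm_eq_abs] at h1
    exact abs_le.1 (h1.trans (mul_le_of_le_one_right (norm_nonneg _)
      (mem_closedBall_zero_iff.1 hφ)))
  · simp [hG]

/-- Each functional is bounded on a weakly compact set; uniform boundedness in the bidual does the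
rest. -/
lemma IsWeaklyCompactSet.exists_norm_le {E : Type*} [NormedAddCommGroup E] [NormedSpace ℝ E]
    {D : Set E} (hD : IsWeaklyCompactSet D) : ∃ M : ℝ, ∀ x ∈ D, ‖x‖ ≤ M := by
  have h : ∀ ξ : StrongDual ℝ E, ∃ C, ∀ x : D,
      ‖NormedSpace.inclusionInDoubleDual ℝ E x ξ‖ ≤ C := fun ξ => by
    obtain ⟨C, hC⟩ := (hD.image (continuous_apply_weakSpace ξ)).isBounded.exists_norm_le
    exact ⟨C, fun x => hC _ ⟨_, ⟨x, x.2, rfl⟩, rfl⟩⟩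
  obtain ⟨M, hM⟩ := banach_steinhaus h
  refine ⟨M, fun x hx => ?_⟩
  have := hM ⟨x, hx⟩
  rwa [← (NormedSpace.inclusionInDoubleDualLi ℝ (E := E)).norm_map x]

lemma exists_strictMono_of_forall_exists {P : ℕ → ℕ → ℕ → Prop}
    (h : ∀ j a, ∃ b, a < b ∧ P j a b) :
    ∃ f : ℕ → ℕ, StrictMono f ∧ f 0 = 0 ∧ ∀ j, P j (f j) (f (j + 1)) := by
  choose g hg hP using h
  let f : ℕ → ℕ := fun j => Nat.rec 0 (fun j a => g j a) j
  exact ⟨f, strictMono_nat_of_lt_succ fun j => hg j (f j), rfl, fun j => hP j (f j)⟩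

namespace James

/-! ### Averages on weakly compact sets -/

/-- Coefficients tend to 0 for each `φ`, so the increasing weakly open sets `O Q` cover `D`, and
compactness yields one `Q`. The index `q` still depends on `φ`. -/
lemma exists_abs_coeff_lt {D : Set JamesDual} (hD : IsWeaklyCompactSet D) (N : ℕ) {δ : ℝ}
    (hδ : 0 < δ) : ∃ Q, N < Q ∧ ∀ φ ∈ D, ∃ q, N ≤ q ∧ q < Q ∧ |coeff q φ| < δ := by
  set O : ℕ → Set (WeakSpace ℝ JamesDual) := fun Q =>
    ⋃ q ∈ Set.Ico N Q, {w | |coeff q ((toWeakSpace ℝ JamesDual).symm w)| < δ} with hO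
  have hOo : ∀ Q, IsOpen (O Q) := fun Q => isOpen_biUnion fun q _ =>
    isOpen_lt (continuous_apply_weakSpace (coeff q)).abs continuous_const
  have hOm : Monotone O := fun Q Q' h => Set.biUnion_subset_biUnion_left
    (Set.Ico_subset_Ico_right h)
  have hcov : toWeakSpace ℝ JamesDual '' D ⊆ ⋃ Q, O Q := by
    rintro _ ⟨φ, -, rfl⟩
    have h1 : ∀ᶠ q in atTop, |coeff q φ| < δ := by
      have := (tendsto_coeff φ).abs
      rw [abs_zero] at this
      exact this.eventually (gt_mem_nhds hδ)
    obtain ⟨q, hq, hNq⟩ := (h1.and (eventually_ge_atTop N)).exists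
    refine Set.mem_iUnion.2 ⟨q + 1, Set.mem_iUnion₂.2 ⟨q, ⟨hNq, q.lt_succ_self⟩, ?_⟩⟩
    exact hq
  obtain ⟨Q, hQ⟩ := hD.elim_directed_cover O hOo hcov hOm.directed_le
  refine ⟨max Q (N + 1), by omega, fun φ hφ => ?_⟩
  obtain ⟨q, hq, h⟩ := Set.mem_iUnion₂.1 (hQ ⟨φ, hφ, rfl⟩)
  exact ⟨q, hq.1, hq.2.trans_le (le_max_left _ _), h⟩

lemma abs_intervalMean_le {a : ℕ → ℝ} {p q : ℕ} (h : p < q) {c : ℝ}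
    (ha : ∀ s, p ≤ s → s < q → |a s| ≤ c) : |intervalMean a p q| ≤ c := by
  have := intervalMean_mem (convex_closedBall (0 : ℝ) c) (u := a) h fun s h1 h2 => by
    simpa using ha s h1 h2
  simpa using this

lemma abs_coeff_le (s : ℕ) (φ : JamesDual) : |coeff s φ| ≤ 2 * ‖φ‖ := by
  have h1 := abs_sub (φ (step s)) (coeffInf φ)
  have h2 := abs_apply_step_le φ s
  have h3 := abs_coeffInf_le φ
  rw [coeff_apply]
  linarith

lemma coeff_sub_coeff (s q : ℕ) (φ : JamesDual) :
    coeff s φ - coeff q φ = φ (step s - step q) := by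
  rw [coeff_apply, coeff_apply, map_sub]
  ring

/-- The coefficients of an element of `J*` oscillate by `δ` on few of the blocks. -/
lemma card_mul_sq_le_of_oscillation {n : ℕ → ℕ} (hn : Monotone n) (φ : JamesDual) (G : Finset ℕ)
    {δ : ℝ} (hδ : 0 < δ) (hG : ∀ i ∈ G, ∃ s q, (n i ≤ s ∧ s < n (i + 1)) ∧
      (n i ≤ q ∧ q < n (i + 1)) ∧ δ ≤ |coeff s φ - coeff q φ|) :
    G.card * δ ^ 2 ≤ 8 * ‖φ‖ ^ 2 := by
  have key : ∀ i, ∃ u : JamesSpace, i ∈ G →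
      (∀ k, u.seq k ≠ 0 → n i ≤ k ∧ k < n (i + 1)) ∧ ‖u‖ ≤ 2 ∧ δ ≤ φ u := fun i => by
    by_cases hi : i ∈ G
    · obtain ⟨s, q, hs, hq, h⟩ := hG i hi
      have hsupp : ∀ s q, (n i ≤ s ∧ s < n (i + 1)) → (n i ≤ q ∧ q < n (i + 1)) →
          ∀ k, (step s - step q).seq k ≠ 0 → n i ≤ k ∧ k < n (i + 1) := by
        intro s q hs hq k hk
        rw [seq_sub, seq_step, seq_step] at hk
        by_cases h1 : k ≤ s <;> by_cases h2 : k ≤ q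
        · simp [h1, h2] at hk
        · omega
        · omega
        · simp [h1, h2] at hk
      rcases le_abs.1 h with h | h
      · exact ⟨step s - step q, fun _ => ⟨hsupp s q hs hq, norm_step_sub_le s q,
          by rwa [← coeff_sub_coeff]⟩⟩
      · exact ⟨step q - step s, fun _ => ⟨hsupp q s hq hs, norm_step_sub_le q s,
          by rwa [← coeff_sub_coeff, ← neg_sub]⟩⟩
    · exact ⟨0, fun h => absurd h hi⟩
  choose u hu using key
  have := card_mul_sq_le hn G u (fun k hk => (hu k hk).1) hδ (fun k hk => (hu k hk).2.1) φ
    fun k hk => (hu k hk).2.2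
  linarith

/-- If each block has a point where the coefficients of `φ` are small, the double averages
of the coefficients over many blocks are small. -/
lemma abs_doubleAverage_le {n : ℕ → ℕ} (hn : StrictMono n) {φ : JamesDual} {M : ℝ}
    (hM : ‖φ‖ ≤ M) {δ : ℝ} (hδ : 0 < δ) {i₀ : ℕ}
    (hq : ∀ i, i₀ ≤ i → ∃ q, n i ≤ q ∧ q < n (i + 1) ∧ |coeff q φ| < δ) {r r' : ℕ} (hr : r < r') :
    |doubleAverage n (fun s => coeff s φ) r r'| ≤
      2 * δ + 2 * M * (i₀ + 8 * M ^ 2 / δ ^ 2) / ((r' : ℝ) - r) := by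
  have hM0 : 0 ≤ M := (norm_nonneg φ).trans hM
  set h : ℕ → ℝ := fun i => intervalMean (fun s => coeff s φ) (n i) (n (i + 1)) with hh
  have hhM : ∀ i, |h i| ≤ 2 * M := fun i => abs_intervalMean_le (hn i.lt_succ_self) fun s _ _ =>
    (abs_coeff_le s φ).trans (by linarith)
  set G := (Finset.Ico r r').filter fun i => 2 * δ < |h i| with hG
  -- On a bad block past `i₀` one coefficient exceeds `2 * δ` and another is below `δ`, so the
  -- oscillation bound limits the number of such blocks. The first `i₀` blocks are all conceded as
  -- bad.
  set G' := G.filter fun i => i₀ ≤ i with hG'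
  have hcard' : (G'.card : ℝ) ≤ 8 * M ^ 2 / δ ^ 2 := by
    rw [le_div_iff₀ (by positivity)]
    refine (card_mul_sq_le_of_oscillation hn.monotone φ G' hδ fun i hi => ?_).trans
      (mul_le_mul_of_nonneg_left (pow_le_pow_left₀ (norm_nonneg φ) hM 2) (by norm_num))
    rw [hG', hG, Finset.mem_filter, Finset.mem_filter] at hi
    obtain ⟨q, hq1, hq2, hq3⟩ := hq i hi.2
    obtain ⟨s, hs1, hs2, hs3⟩ : ∃ s, n i ≤ s ∧ s < n (i + 1) ∧ 2 * δ < |coeff s φ| := by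
      by_contra! hcon
      exact absurd (abs_intervalMean_le (hn i.lt_succ_self) hcon) (not_le.2 hi.1.2)
    refine ⟨s, q, ⟨hs1, hs2⟩, ⟨hq1, hq2⟩, ?_⟩
    have := abs_sub_abs_le_abs_sub (coeff s φ) (coeff q φ)
    linarith
  have hcard : (G.card : ℝ) ≤ i₀ + 8 * M ^ 2 / δ ^ 2 := by
    have h1 : G ⊆ Finset.range i₀ ∪ G' := fun i hi => by
      rw [Finset.mem_union, Finset.mem_range, hG', Finset.mem_filter]
      by_cases hi₀ : i₀ ≤ i
      · exact Or.inr ⟨hi, hi₀⟩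
      · exact Or.inl (not_le.1 hi₀)
    have h2 := (Finset.card_le_card h1).trans (Finset.card_union_le _ _)
    rw [Finset.card_range] at h2
    have h3 : (G.card : ℝ) ≤ i₀ + G'.card := by exact_mod_cast h2
    linarith
  have hpos : (0 : ℝ) < (r' : ℝ) - r := sub_pos.2 (by exact_mod_cast hr)
  have hsum : ∑ i ∈ Finset.Ico r r', |h i| ≤
      2 * δ * ((r' : ℝ) - r) + 2 * M * (i₀ + 8 * M ^ 2 / δ ^ 2) := by
    calc ∑ i ∈ Finset.Ico r r', |h i|
        ≤ ∑ i ∈ Finset.Ico r r', (2 * δ + if 2 * δ < |h i| then 2 * M else 0) := by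
          refine Finset.sum_le_sum fun i _ => ?_
          split_ifs with hi
          · linarith [hhM i]
          · linarith
      _ = 2 * δ * ((r' : ℝ) - r) + 2 * M * G.card := by
          rw [Finset.sum_add_distrib, ← Finset.sum_filter, Finset.sum_const, Finset.sum_const,
            Nat.card_Ico, nsmul_eq_mul, nsmul_eq_mul, Nat.cast_sub hr.le]
          ring
      _ ≤ _ := add_le_add le_rfl (mul_le_mul_of_nonneg_left hcard (by positivity))
  have e : |doubleAverage n (fun s => coeff s φ) r r'| ≤
      (∑ i ∈ Finset.Ico r r', |h i|) / ((r' : ℝ) - r) := by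
    rw [doubleAverage, abs_div, abs_of_pos hpos]
    simp only [blockAverage_eq]
    exact div_le_div_of_nonneg_right (Finset.abs_sum_le_sum_abs _ _) hpos.le
  refine e.trans ?_
  rw [div_le_iff₀ hpos, add_mul, div_mul_cancel₀ _ hpos.ne']
  exact hsum

/-- On a weakly compact set the double averages can be made uniformly small. -/
lemma exists_abs_doubleAverage_le {D : Set JamesDual} (hD : IsWeaklyCompactSet D) {ε : ℝ}
    (hε : 0 < ε) : ∃ n r : ℕ → ℕ, StrictMono n ∧ n 0 = 0 ∧ StrictMono r ∧ r 0 = 0 ∧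
      ∀ j, ∀ φ ∈ D, |doubleAverage n (fun s => coeff s φ) (r j) (r (j + 1))| ≤
        ε * (1 / 2) ^ j := by
  obtain ⟨M, hM⟩ := hD.exists_norm_le
  -- The thresholds tend to 0 along the blocks, so a single `n` serves every accuracy demanded later
  -- in the choice of `r`.
  obtain ⟨n, hn, hn0, hnq⟩ := exists_strictMono_of_forall_exists fun j a =>
    exists_abs_coeff_lt hD a (δ := 1 / ((j : ℝ) + 1)) (by positivity)
  obtain ⟨r, hr, hr0, hrd⟩ := exists_strictMono_of_forall_exists
    (P := fun j a b => ∀ φ ∈ D, |doubleAverage n (fun s => coeff s φ) a b| ≤ ε * (1 / 2) ^ j) <| by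
    intro j a
    set η : ℝ := ε * (1 / 2) ^ j with hη
    have hη0 : 0 < η := by positivity
    -- With `δ = η / 4` the good blocks contribute `η / 2`; then `m` is taken so large that the bad
    -- blocks, bounded by `K / (m + 1)`, contribute at most another `η / 2`.
    obtain ⟨i₀, hi₀⟩ := exists_nat_one_div_lt (by positivity : 0 < η / 4)
    set K : ℝ := 2 * M * (i₀ + 8 * M ^ 2 / (η / 4) ^ 2) with hK
    obtain ⟨m, hm⟩ := exists_nat_gt (2 * K / η)
    refine ⟨a + (m + 1), by omega, fun φ hφ => ?_⟩
    have h1 := abs_doubleAverage_le hn (hM φ hφ) (by positivity : 0 < η / 4) (i₀ := i₀)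
      (fun i hi => by
        obtain ⟨q, hq1, hq2, hq3⟩ := hnq i φ hφ
        refine ⟨q, hq1, hq2, hq3.trans (lt_of_le_of_lt ?_ hi₀)⟩
        exact one_div_le_one_div_of_le (by positivity) (by exact_mod_cast Nat.succ_le_succ hi))
      (show a < a + (m + 1) by omega)
    have h2 : K / (((a + (m + 1) : ℕ) : ℝ) - a) ≤ η / 2 := by
      have hc : ((a + (m + 1) : ℕ) : ℝ) - a = m + 1 := by push_cast; ring
      rw [hc, div_le_iff₀ (by positivity)]
      rw [div_lt_iff₀ hη0] at hm
      nlinarith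
    linarith
  exact ⟨n, r, hn, hn0, hr, hr0, hrd⟩

/-! ### Assembling the operator -/

lemma exists_averaging_operator {D : Set JamesDual} (hD : IsWeaklyCompactSet D) {ε : ℝ}
    (hε : 0 < ε) :
    ∃ n r : ℕ → ℕ, StrictMono n ∧ n 0 = 0 ∧ StrictMono r ∧ r 0 = 0 ∧
      ∃ B : ℕ → StrongDual ℝ JamesDual,
        (∀ (j : ℕ) (φ : JamesDual) (a : ℕ → ℝ) (aInf : ℝ), IsExpansion φ a aInf →
          B j φ = doubleAverage n a (r j) (r (j + 1))) ∧
        ∃ V : JamesDual →L[ℝ] JamesDual,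
          (∀ φ : JamesDual,
            Tendsto (fun N : ℕ => φ - ∑ j ∈ Finset.range N,
              B j φ • intervalStar (n (r j)) (n (r (j + 1)))) atTop (𝓝 (V φ))) ∧
          IsWeaklyCompactOperator V ∧ ‖V‖ ≤ 7 ∧
          ∃ δ : ℝ, δ < ε ∧ ∀ φ ∈ D, ‖φ - V φ‖ ≤ δ := by
  obtain ⟨n, r, hn, hn0, hr, hr0, hsmall⟩ :=
    -- Since `‖I_j*‖ ≤ 2` and the geometric sum is at most 2, the choice `ε / 8` leaves `‖U φ‖ ≤ ε /
    -- 2` on `D`.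
    exists_abs_doubleAverage_le hD (by positivity : 0 < ε / 8)
  have hp : StrictMono fun j => n (r j) := hn.comp hr
  have hF := fun j : ℕ => stepMean_mem hn (hr j.lt_succ_self)
  have hB := fun j : ℕ => meanFunctional_stepMean hn (hr j.lt_succ_self)
  obtain ⟨U, hU, hUn⟩ := exists_limit_operator hp hF
  refine ⟨n, r, hn, hn0, hr, hr0, fun j => meanFunctional (stepMean n (r j) (r (j + 1))),
    fun j φ a aInf ha => ?_, ContinuousLinearMap.id ℝ JamesDual - U, fun φ => ?_, ?_, ?_,
    ε / 2, half_lt_self hε, fun φ hφ => ?_⟩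
  · rw [ha.unique.1]
    exact hB j φ
  · exact (hU φ).const_sub φ
  · exact isWeaklyCompactOperator_of_predual _ coeffInf sInftyStar
      (exists_predual hp (by rw [hr0, hn0]) hF hU)
  · refine ContinuousLinearMap.opNorm_le_bound _ (by norm_num) fun φ => ?_
    refine (norm_sub_le φ (U φ)).trans ?_
    have := hUn φ
    have := norm_nonneg φ
    linarith
  · have e : φ - (ContinuousLinearMap.id ℝ JamesDual - U) φ = U φ := sub_sub_cancel φ (U φ)
    rw [e]
    refine le_of_tendsto (hU φ).norm (Eventually.of_forall fun N => ?_)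
    calc _ ≤ ∑ j ∈ Finset.range N, ε / 8 * (1 / 2) ^ j * 2 := by
          refine norm_sum_le_of_le _ fun j _ => ?_
          rw [norm_smul, Real.norm_eq_abs, hB j φ]
          exact mul_le_mul (hsmall j φ hφ)
            (norm_intervalStar_le (hp.monotone j.le_succ)) (norm_nonneg _) (by positivity)
      _ = ε / 4 * ∑ j ∈ Finset.range N, (1 / 2 : ℝ) ^ j := by
          rw [Finset.mul_sum]
          exact Finset.sum_congr rfl fun j _ => by ring
      _ ≤ ε / 4 * 2 := mul_le_mul_of_nonneg_left (sum_geometric_two_le N) (by positivity)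
      _ = ε / 2 := by ring

end James

theorem theorem3p3 :
    -- `J*` has the weakly compact approximation property with constant `7`
    HasWAPWith James.JamesDual 7 ∧
    -- the basis expansion through which the averaging functionals are defined
    (∀ φ : James.JamesDual, ∃! c : (ℕ → ℝ) × ℝ, James.IsExpansion φ c.1 c.2) ∧
    -- the approximating operators can be taken of the form `V = I - ∑_j B_j(·) I_j*`
    ∀ D : Set James.JamesDual, IsWeaklyCompactSet D → ∀ ε : ℝ, 0 < ε →
      ∃ n r : ℕ → ℕ, StrictMono n ∧ n 0 = 0 ∧ StrictMono r ∧ r 0 = 0 ∧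
        ∃ B : ℕ → StrongDual ℝ James.JamesDual,
          (∀ (j : ℕ) (φ : James.JamesDual) (a : ℕ → ℝ) (aInf : ℝ), James.IsExpansion φ a aInf →
            B j φ = James.doubleAverage n a (r j) (r (j + 1))) ∧
          ∃ V : James.JamesDual →L[ℝ] James.JamesDual,
            (∀ φ : James.JamesDual,
              Tendsto (fun N : ℕ => φ - ∑ j ∈ Finset.range N,
                B j φ • James.intervalStar (n (r j)) (n (r (j + 1)))) atTop (𝓝 (V φ))) ∧
            IsWeaklyCompactOperator V ∧ ‖V‖ ≤ 7 ∧
            ∃ δ : ℝ, δ < ε ∧ ∀ φ ∈ D, ‖φ - V φ‖ ≤ δ := by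
  refine ⟨fun D hD ε hε => ?_, James.existsUnique_isExpansion, fun D hD ε hε =>
    James.exists_averaging_operator hD hε⟩
  obtain ⟨n, r, -, -, -, -, B, -, V, -, hV⟩ := James.exists_averaging_operator hD hε
  exact ⟨V, hV⟩
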